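/- **Theorem (Wigner–Eckart for $U_t(su(2))$).** Let $t$ be a real number, $t\neq 0,\pm1$, and let $U_t(su(2))$ be the complex Hopf algebra with generators $e,f,k^{\pm1}$, relations $kk^{-1}=k^{-1}k=1$, $ke=t^2ek$, $kf=t^{-2}fk$, $[e,f]=\dfrac{k^2-k^{-2}}{t^2-t^{-2}}$, coproduct $\Delta(k^{\pm1})=k^{\pm1}\otimes k^{\pm1}$, $\Delta(e)=e\otimes k^{-1}+k\otimes e$, $\Delta(f)=f\otimes k^{-1}+k\otimes f$, counit $\varepsilon(k^{\pm1})=1$, $\varepsilon(e)=\varepsilon(f)=0$ and antipode $S(k)=k^{-1}$, $S(e)=-t^{-2}e$, $S(f)=-t^2f$. For $l\in\{0,\frac12,1,\dots\}$ let $(V^l,\pi^l)$ be the irreducible representation on the complex space with weight basis $e^l_m$, $m=-l,\dots,l$, given by $$e\,e^l_m=([l-m][l+m+1])^{1/2}e^l_{m+1},\quad f\,e^l_m=([l+m][l-m+1])^{1/2}e^l_{m-1},\quad k^{\pm1}e^l_m=t^{\pm2m}e^l_m,\qquad [n]=\frac{t^{2n}-t^{-2n}}{t^2-t^{-2}}.$$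 Let $k,l,j\in\{0,\frac12,1,\dots\}$. There are isomorphisms of representations $V^k\otimes V^l\cong\bigoplus_{i=|k-l|}^{k+l}V^i$, where the algebra acts on the tensor product through $\Delta$. Given such an isomorphism, write $$e^k_p\otimes e^l_n=\sum_{i=|k-l|}^{k+l}\sum_m (kp,ln\mid im)_t\,e^i_m ,$$ where $e^i_m$ denotes the vector corresponding to the weight basis vector of the summand $V^i$; the numbers $(kp,ln\mid im)_t$ are the quantum Clebsch–Gordan coefficients (they depend on the isomorphism through one non-zero factor for each $i$), and $(kp,ln\mid im)_t=0$ if $V^i$ does not occur in the sum. The isomorphism can be chosen so that all the coefficients are real. Let $T\in \mathrm{Hom}(V^k,\mathrm{Hom}(V^l,V^j))$ be an (irreducible) tensor operator, that is, a linear map with $$T(\pi^k(a)v)=\sum_i\pi^j(a_i^{(1)})\circ T(v)\circ\pi^l(S(a_i^{(2)}))\qquad\text{for all }a\in U_t(su(2)),\ v\in V^k,\qquad \Delta(a)=\sum_i a_i^{(1)}\otimes a_i^{(2)}.$$ Then, for every choice of the isomorphism above, there is a number $\alpha\in\mathbb C$ (the reduced matrix element), which does not depend on $p,m,n$, such that the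 matrix elements of the components of $T$ in the weight bases, $T(e^k_p)e^l_n=\sum_m[T(e^k_p)]_{mn}e^j_m$, are $$[T(e^k_p)]_{mn}=\alpha\,(kp,ln\mid jm)_t\qquad\text{for all }p,m,n.$$ If moreover the coefficients $(kp,ln\mid jm)_t$ and all the matrix elements $[T(e^k_p)]_{mn}$ are real, then $\alpha$ can be taken real. -/

import Mathlib

open scoped TensorProduct

noncomputable section

/-! ### Tensor operators for Hopf algebras -/

section Hopf

variable {A : Type*} [Ring A] [HopfAlgebra ℂ A]
variable {V W U : Type*} [AddCommGroup V] [Module ℂ V] [AddCommGroup W] [Module ℂ W]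
  [AddCommGroup U] [Module ℂ U]

/-- The action `δ` of a Hopf algebra `A` on `Hom(W, U)`:
`δ(a) g = ∑ σ(a⁽¹⁾) ∘ g ∘ ρ(S(a⁽²⁾))`. -/
def homRep (ρ : A →ₐ[ℂ] Module.End ℂ W) (σ : A →ₐ[ℂ] Module.End ℂ U) :
    A →ₗ[ℂ] Module.End ℂ (W →ₗ[ℂ] U) :=
  TensorProduct.lift
    (LinearMap.mk₂ ℂ
      (fun a b : A =>
        (LinearMap.lcomp ℂ U (ρ (HopfAlgebra.antipode ℂ b))) ∘ₗ
          (LinearMap.compRight ℂ (σ a) : (W →ₗ[ℂ] U) →ₗ[ℂ] (W →ₗ[ℂ] U)))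
      (fun a a' b => by ext g w; simp)
      (fun c a b => by ext g w; simp)
      (fun a b b' => by ext g w; simp)
      (fun c a b => by ext g w; simp))
    ∘ₗ Coalgebra.comul

/-- The tensor product representation `a ↦ (π ⊗ ρ)(Δ a)` on `V ⊗ W`. -/
def tensorRep (π : A →ₐ[ℂ] Module.End ℂ V) (ρ : A →ₐ[ℂ] Module.End ℂ W) :
    A →ₐ[ℂ] Module.End ℂ (V ⊗[ℂ] W) :=
  ((Module.endTensorEndAlgHom (R := ℂ) (S := ℂ) (A := ℂ) (M := V) (N := W)).comp
    (Algebra.TensorProduct.map π ρ)).comp (Bialgebra.comulAlgHom ℂ A)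

/-- `T ∈ Hom(V, Hom(W, U))` is a tensor operator when it is a homomorphism of representations
from `(V, π)` to `(Hom(W, U), δ)`. -/
def IsTensorOperator (π : A →ₐ[ℂ] Module.End ℂ V) (ρ : A →ₐ[ℂ] Module.End ℂ W)
    (σ : A →ₐ[ℂ] Module.End ℂ U) (T : V →ₗ[ℂ] (W →ₗ[ℂ] U)) : Prop :=
  ∀ a : A, T ∘ₗ π a = homRep ρ σ a ∘ₗ T

end Hopf

/-! ### The Hopf algebra `U_t(su(2))`, for a nonzero real parameter `t` -/

namespace Usu2

/-- The generators `e, f, k, k⁻¹`. -/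
inductive Gen
  | e | f | k | kinv

open Gen in
/-- The defining relations. -/
inductive Rel (t : ℝˣ) : FreeAlgebra ℂ Gen → FreeAlgebra ℂ Gen → Prop
  | k_kinv : Rel t (FreeAlgebra.ι ℂ k * FreeAlgebra.ι ℂ kinv) 1
  | kinv_k : Rel t (FreeAlgebra.ι ℂ kinv * FreeAlgebra.ι ℂ k) 1
  | k_e : Rel t (FreeAlgebra.ι ℂ k * FreeAlgebra.ι ℂ e)
      (((t : ℝ) : ℂ) ^ 2 • (FreeAlgebra.ι ℂ e * FreeAlgebra.ι ℂ k))
  | k_f : Rel t (FreeAlgebra.ι ℂ k * FreeAlgebra.ι ℂ f)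
      (((t : ℝ) : ℂ) ^ (-2 : ℤ) • (FreeAlgebra.ι ℂ f * FreeAlgebra.ι ℂ k))
  | e_f : Rel t
      (FreeAlgebra.ι ℂ e * FreeAlgebra.ι ℂ f - FreeAlgebra.ι ℂ f * FreeAlgebra.ι ℂ e)
      ((((t : ℝ) : ℂ) ^ 2 - ((t : ℝ) : ℂ) ^ (-2 : ℤ))⁻¹ •
        (FreeAlgebra.ι ℂ k ^ 2 - FreeAlgebra.ι ℂ kinv ^ 2))

end Usu2

/-- The algebra with generators `e, f, k, k⁻¹` and relations `k k⁻¹ = k⁻¹ k = 1`,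
`k e = t² e k`, `k f = t⁻² f k`, `[e, f] = (k² - k⁻²) / (t² - t⁻²)`. -/
def Usu2 (t : ℝˣ) : Type := RingQuot (Usu2.Rel t)

namespace Usu2

variable (t : ℝˣ)

instance : Ring (Usu2 t) := inferInstanceAs (Ring (RingQuot (Usu2.Rel t)))

instance : Algebra ℂ (Usu2 t) := inferInstanceAs (Algebra ℂ (RingQuot (Usu2.Rel t)))

/-- The class of a generator. -/
def gen (x : Gen) : Usu2 t := RingQuot.mkAlgHom ℂ (Rel t) (FreeAlgebra.ι ℂ x)

abbrev e : Usu2 t := gen t Gen.e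
abbrev f : Usu2 t := gen t Gen.f
abbrev k : Usu2 t := gen t Gen.k
abbrev kinv : Usu2 t := gen t Gen.kinv

theorem k_mul_kinv : k t * kinv t = 1 := by
  simpa using! RingQuot.mkAlgHom_rel ℂ (Rel.k_kinv (t := t))

theorem kinv_mul_k : kinv t * k t = 1 := by
  simpa using! RingQuot.mkAlgHom_rel ℂ (Rel.kinv_k (t := t))

theorem k_mul_e : k t * e t = ((t : ℝ) : ℂ) ^ 2 • (e t * k t) := by
  simpa using! RingQuot.mkAlgHom_rel ℂ (Rel.k_e (t := t))

theorem k_mul_f : k t * f t = ((t : ℝ) : ℂ) ^ (-2 : ℤ) • (f t * k t) := by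
  simpa using! RingQuot.mkAlgHom_rel ℂ (Rel.k_f (t := t))

theorem e_mul_f_sub : e t * f t - f t * e t =
    (((t : ℝ) : ℂ) ^ 2 - ((t : ℝ) : ℂ) ^ (-2 : ℤ))⁻¹ • (k t ^ 2 - kinv t ^ 2) := by
  simpa using! RingQuot.mkAlgHom_rel ℂ (Rel.e_f (t := t))

theorem ne0 : ((t : ℝ) : ℂ) ≠ 0 := by exact_mod_cast t.ne_zero

variable {t}

/-- The algebra homomorphism determined by the images of the generators. -/
def lift {B : Type*} [Ring B] [Algebra ℂ B] (E F K K' : B)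
    (h1 : K * K' = 1) (h2 : K' * K = 1)
    (h3 : K * E = ((t : ℝ) : ℂ) ^ 2 • (E * K))
    (h4 : K * F = ((t : ℝ) : ℂ) ^ (-2 : ℤ) • (F * K))
    (h5 : E * F - F * E =
      (((t : ℝ) : ℂ) ^ 2 - ((t : ℝ) : ℂ) ^ (-2 : ℤ))⁻¹ • (K ^ 2 - K' ^ 2)) :
    Usu2 t →ₐ[ℂ] B :=
  RingQuot.liftAlgHom ℂ ⟨FreeAlgebra.lift ℂ (fun x => match x with
    | Gen.e => E | Gen.f => F | Gen.k => K | Gen.kinv => K'), by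
      intro x y h
      induction h with
      | k_kinv => simpa using h1
      | kinv_k => simpa using h2
      | k_e => simpa using h3
      | k_f => simpa using h4
      | e_f => simpa using h5⟩

section lift
variable {B : Type*} [Ring B] [Algebra ℂ B] {E F K K' : B}
    (h1 : K * K' = 1) (h2 : K' * K = 1)
    (h3 : K * E = ((t : ℝ) : ℂ) ^ 2 • (E * K))
    (h4 : K * F = ((t : ℝ) : ℂ) ^ (-2 : ℤ) • (F * K))
    (h5 : E * F - F * E =
      (((t : ℝ) : ℂ) ^ 2 - ((t : ℝ) : ℂ) ^ (-2 : ℤ))⁻¹ • (K ^ 2 - K' ^ 2))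

@[simp] theorem lift_e : lift E F K K' h1 h2 h3 h4 h5 (e t) = E := by
  refine (RingQuot.liftAlgHom_mkAlgHom_apply ℂ _ _ _).trans ?_
  simp
@[simp] theorem lift_f : lift E F K K' h1 h2 h3 h4 h5 (f t) = F := by
  refine (RingQuot.liftAlgHom_mkAlgHom_apply ℂ _ _ _).trans ?_
  simp
@[simp] theorem lift_k : lift E F K K' h1 h2 h3 h4 h5 (k t) = K := by
  refine (RingQuot.liftAlgHom_mkAlgHom_apply ℂ _ _ _).trans ?_
  simp
@[simp] theorem lift_kinv : lift E F K K' h1 h2 h3 h4 h5 (kinv t) = K' := by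
  refine (RingQuot.liftAlgHom_mkAlgHom_apply ℂ _ _ _).trans ?_
  simp
end lift

theorem hom_ext {B : Type*} [Ring B] [Algebra ℂ B] {φ ψ : Usu2 t →ₐ[ℂ] B}
    (he : φ (e t) = ψ (e t)) (hf : φ (f t) = ψ (f t)) (hk : φ (k t) = ψ (k t))
    (hk' : φ (kinv t) = ψ (kinv t)) : φ = ψ := by
  refine RingQuot.ringQuot_ext' ℂ φ ψ (FreeAlgebra.hom_ext (funext fun x => ?_))
  cases x
  · exact he
  · exact hf
  · exact hk
  · exact hk'

theorem induction {P : Usu2 t → Prop} (hc : ∀ c : ℂ, P (algebraMap ℂ _ c))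
    (hg : ∀ x, P (gen t x)) (hm : ∀ x y, P x → P y → P (x * y))
    (ha : ∀ x y, P x → P y → P (x + y)) (x : Usu2 t) : P x := by
  obtain ⟨y, rfl⟩ := RingQuot.mkAlgHom_surjective ℂ (Rel t) x
  induction y using FreeAlgebra.induction with
  | grade0 r => simpa using! hc r
  | grade1 x => exact hg x
  | mul a b h1 h2 => simpa using! hm _ _ h1 h2
  | add a b h1 h2 => simpa using! ha _ _ h1 h2

variable (t)

theorem e_mul_k : e t * k t = ((t : ℝ) : ℂ) ^ (-2 : ℤ) • (k t * e t) := by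
  have := ne0 t
  rw [k_mul_e, smul_smul]
  field_simp
  simp

theorem f_mul_k : f t * k t = ((t : ℝ) : ℂ) ^ 2 • (k t * f t) := by
  have := ne0 t
  rw [k_mul_f, smul_smul]
  field_simp
  simp

theorem kinv_mul_e : kinv t * e t = ((t : ℝ) : ℂ) ^ (-2 : ℤ) • (e t * kinv t) := by
  calc kinv t * e t = kinv t * (e t * k t) * kinv t := by
        simp only [mul_assoc, k_mul_kinv, mul_one]
    _ = _ := by
        rw [e_mul_k, mul_smul_comm, ← mul_assoc, kinv_mul_k, one_mul, smul_mul_assoc]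

theorem kinv_mul_f : kinv t * f t = ((t : ℝ) : ℂ) ^ 2 • (f t * kinv t) := by
  calc kinv t * f t = kinv t * (f t * k t) * kinv t := by
        simp only [mul_assoc, k_mul_kinv, mul_one]
    _ = _ := by
        rw [f_mul_k, mul_smul_comm, ← mul_assoc, kinv_mul_k, one_mul, smul_mul_assoc]

/-- The coproduct: `Δ(k^{±1}) = k^{±1} ⊗ k^{±1}`, `Δ(e) = e ⊗ k⁻¹ + k ⊗ e`,
`Δ(f) = f ⊗ k⁻¹ + k ⊗ f`. -/
def comulHom : Usu2 t →ₐ[ℂ] Usu2 t ⊗[ℂ] Usu2 t :=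
  lift (e t ⊗ₜ kinv t + k t ⊗ₜ e t) (f t ⊗ₜ kinv t + k t ⊗ₜ f t) (k t ⊗ₜ k t)
    (kinv t ⊗ₜ kinv t)
    (by simp [k_mul_kinv, Algebra.TensorProduct.one_def])
    (by simp [kinv_mul_k, Algebra.TensorProduct.one_def])
    (by
      simp only [mul_add, add_mul, Algebra.TensorProduct.tmul_mul_tmul, k_mul_e, k_mul_kinv,
        kinv_mul_k, smul_add, TensorProduct.smul_tmul', TensorProduct.tmul_smul])
    (by
      simp only [mul_add, add_mul, Algebra.TensorProduct.tmul_mul_tmul, k_mul_f, k_mul_kinv,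
        kinv_mul_k, smul_add, TensorProduct.smul_tmul', TensorProduct.tmul_smul])
    (by
      have h0 := ne0 t
      have h := e_mul_f_sub t
      have hc : (((t : ℝ) : ℂ) ^ (-2 : ℤ)) * ((t : ℝ) : ℂ) ^ 2 = 1 := by field_simp
      have e1 : (e t * k t) ⊗ₜ[ℂ] (kinv t * f t) = (k t * e t) ⊗ₜ[ℂ] (f t * kinv t) := by
        rw [e_mul_k, kinv_mul_f, TensorProduct.smul_tmul, smul_smul, hc, one_smul]
      have e2 : (k t * f t) ⊗ₜ[ℂ] (e t * kinv t) = (f t * k t) ⊗ₜ[ℂ] (kinv t * e t) := by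
        rw [k_mul_f, kinv_mul_e, TensorProduct.smul_tmul]
      have e3 : e t * f t = f t * e t +
          (((t : ℝ) : ℂ) ^ 2 - ((t : ℝ) : ℂ) ^ (-2 : ℤ))⁻¹ • (k t ^ 2 - kinv t ^ 2) := by
        rw [← h]; abel
      simp only [mul_add, add_mul, Algebra.TensorProduct.tmul_mul_tmul, e1, e2, e3,
        pow_two, TensorProduct.tmul_add, TensorProduct.add_tmul, TensorProduct.tmul_smul,
        ← TensorProduct.smul_tmul', TensorProduct.tmul_sub, TensorProduct.sub_tmul, smul_sub]
      abel)

/-- The counit: `ε(k^{±1}) = 1`, `ε(e) = ε(f) = 0`. -/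
def counitHom : Usu2 t →ₐ[ℂ] ℂ :=
  lift 0 0 1 1 (by simp) (by simp) (by simp) (by simp) (by simp)

/-- The antipode, as an algebra homomorphism to the opposite algebra: `S(k^{±1}) = k^{∓1}`,
`S(e) = -t⁻² e`, `S(f) = -t² f`. -/
def antipodeHom : Usu2 t →ₐ[ℂ] (Usu2 t)ᵐᵒᵖ :=
  lift (MulOpposite.op (-(((t : ℝ) : ℂ) ^ (-2 : ℤ) • e t)))
    (MulOpposite.op (-(((t : ℝ) : ℂ) ^ 2 • f t)))
    (MulOpposite.op (kinv t)) (MulOpposite.op (k t))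
    (by simp [← MulOpposite.op_mul, k_mul_kinv])
    (by simp [← MulOpposite.op_mul, kinv_mul_k])
    (by
      rw [← MulOpposite.op_mul, ← MulOpposite.op_mul, ← MulOpposite.op_smul]
      congr 1
      have h0 := ne0 t
      rw [mul_neg, neg_mul, smul_neg, mul_smul_comm, smul_mul_assoc, kinv_mul_e, smul_smul,
        smul_smul]
      congr 2
      field_simp)
    (by
      rw [← MulOpposite.op_mul, ← MulOpposite.op_mul, ← MulOpposite.op_smul]
      congr 1
      have h0 := ne0 t
      rw [mul_neg, neg_mul, smul_neg, mul_smul_comm, smul_mul_assoc, kinv_mul_f, smul_smul,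
        smul_smul]
      congr 2
      field_simp)
    (by
      have h0 := ne0 t
      have hc : (((t : ℝ) : ℂ) ^ (-2 : ℤ)) * ((t : ℝ) : ℂ) ^ 2 = 1 := by field_simp
      have hc' : ((t : ℝ) : ℂ) ^ 2 * (((t : ℝ) : ℂ) ^ (-2 : ℤ)) = 1 := by rw [mul_comm, hc]
      rw [← MulOpposite.op_mul, ← MulOpposite.op_mul, ← MulOpposite.op_pow,
        ← MulOpposite.op_pow, ← MulOpposite.op_sub, ← MulOpposite.op_sub, ← MulOpposite.op_smul]
      congr 1
      rw [neg_mul_neg, neg_mul_neg, smul_mul_smul_comm, smul_mul_smul_comm, hc, hc', one_smul,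
        one_smul, ← neg_sub, e_mul_f_sub, ← smul_neg, neg_sub])

@[simp] theorem comulHom_e : comulHom t (e t) = e t ⊗ₜ kinv t + k t ⊗ₜ e t := lift_e ..
@[simp] theorem comulHom_f : comulHom t (f t) = f t ⊗ₜ kinv t + k t ⊗ₜ f t := lift_f ..
@[simp] theorem comulHom_k : comulHom t (k t) = k t ⊗ₜ k t := lift_k ..
@[simp] theorem comulHom_kinv : comulHom t (kinv t) = kinv t ⊗ₜ kinv t := lift_kinv ..
@[simp] theorem counitHom_e : counitHom t (e t) = 0 := lift_e ..
@[simp] theorem counitHom_f : counitHom t (f t) = 0 := lift_f ..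
@[simp] theorem counitHom_k : counitHom t (k t) = 1 := lift_k ..
@[simp] theorem counitHom_kinv : counitHom t (kinv t) = 1 := lift_kinv ..
@[simp] theorem antipodeHom_e : antipodeHom t (e t) =
    MulOpposite.op (-(((t : ℝ) : ℂ) ^ (-2 : ℤ) • e t)) := lift_e ..
@[simp] theorem antipodeHom_f : antipodeHom t (f t) =
    MulOpposite.op (-(((t : ℝ) : ℂ) ^ 2 • f t)) := lift_f ..
@[simp] theorem antipodeHom_k : antipodeHom t (k t) = MulOpposite.op (kinv t) := lift_k ..
@[simp] theorem antipodeHom_kinv : antipodeHom t (kinv t) = MulOpposite.op (k t) := lift_kinv ..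

instance : Bialgebra ℂ (Usu2 t) :=
  Bialgebra.ofAlgHom (comulHom t) (counitHom t)
    (by
      apply hom_ext <;>
        simp [TensorProduct.tmul_add, TensorProduct.add_tmul, add_assoc])
    (by apply hom_ext <;> simp)
    (by apply hom_ext <;> simp)

/-- The antipode as a linear map. -/
def antipodeLin : Usu2 t →ₗ[ℂ] Usu2 t :=
  (MulOpposite.opLinearEquiv ℂ).symm.toLinearMap ∘ₗ (antipodeHom t).toLinearMap

theorem antipodeLin_mul (x y : Usu2 t) :
    antipodeLin t (x * y) = antipodeLin t y * antipodeLin t x := by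
  simp [antipodeLin]

theorem antipodeLin_algebraMap (c : ℂ) :
    antipodeLin t (algebraMap ℂ (Usu2 t) c) = algebraMap ℂ (Usu2 t) c := by
  simp [antipodeLin]

@[simp] theorem antipodeLin_one : antipodeLin t 1 = 1 := by
  simp [antipodeLin]

@[simp] theorem antipodeLin_e :
    antipodeLin t (e t) = -(((t : ℝ) : ℂ) ^ (-2 : ℤ) • e t) := by
  simp [antipodeLin]

@[simp] theorem antipodeLin_f : antipodeLin t (f t) = -(((t : ℝ) : ℂ) ^ 2 • f t) := by
  simp [antipodeLin]

@[simp] theorem antipodeLin_k : antipodeLin t (k t) = kinv t := by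
  simp [antipodeLin]

@[simp] theorem antipodeLin_kinv : antipodeLin t (kinv t) = k t := by
  simp [antipodeLin]

theorem antipode_left (x : Usu2 t) :
    LinearMap.mul' ℂ (Usu2 t) ((antipodeLin t).rTensor (Usu2 t) (comulHom t x)) =
      algebraMap ℂ _ (counitHom t x) := by
  induction x using induction with
  | hc c => simp [Algebra.TensorProduct.algebraMap_apply, antipodeLin_algebraMap]
  | hg x =>
    have h0 := ne0 t
    cases x
    · change LinearMap.mul' ℂ (Usu2 t) ((antipodeLin t).rTensor (Usu2 t) (comulHom t (e t))) =
        algebraMap ℂ _ (counitHom t (e t))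
      simp [kinv_mul_e]
    · change LinearMap.mul' ℂ (Usu2 t) ((antipodeLin t).rTensor (Usu2 t) (comulHom t (f t))) =
        algebraMap ℂ _ (counitHom t (f t))
      simp [kinv_mul_f]
    · change LinearMap.mul' ℂ (Usu2 t) ((antipodeLin t).rTensor (Usu2 t) (comulHom t (k t))) =
        algebraMap ℂ _ (counitHom t (k t))
      simp [kinv_mul_k]
    · change LinearMap.mul' ℂ (Usu2 t) ((antipodeLin t).rTensor (Usu2 t) (comulHom t (kinv t))) =
        algebraMap ℂ _ (counitHom t (kinv t))
      simp [k_mul_kinv]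
  | hm x y hx hy =>
    have key : ∀ z w : Usu2 t ⊗[ℂ] Usu2 t, ∀ c : ℂ,
        LinearMap.mul' ℂ (Usu2 t) ((antipodeLin t).rTensor (Usu2 t) z) = algebraMap ℂ _ c →
        LinearMap.mul' ℂ (Usu2 t) ((antipodeLin t).rTensor (Usu2 t) (z * w)) =
          c • LinearMap.mul' ℂ (Usu2 t) ((antipodeLin t).rTensor (Usu2 t) w) := by
      intro z w c hz
      induction w with
      | zero => simp
      | add w w' h h' => simp only [mul_add, map_add, h, h', smul_add]
      | tmul a b =>
        have : ∀ z : Usu2 t ⊗[ℂ] Usu2 t,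
            LinearMap.mul' ℂ (Usu2 t) ((antipodeLin t).rTensor (Usu2 t) (z * a ⊗ₜ b)) =
            antipodeLin t a *
              LinearMap.mul' ℂ (Usu2 t) ((antipodeLin t).rTensor (Usu2 t) z) * b := by
          intro z
          induction z with
          | zero => simp
          | add z z' h h' => simp only [add_mul, map_add, h, h', mul_add]
          | tmul p q => simp [antipodeLin_mul, mul_assoc]
        rw [this, hz]
        simp [Algebra.algebraMap_eq_smul_one]
    rw [map_mul, key _ _ _ hx, hy, map_mul, map_mul, Algebra.smul_def]
  | ha x y hx hy => simp only [map_add, hx, hy]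

theorem antipode_right (x : Usu2 t) :
    LinearMap.mul' ℂ (Usu2 t) ((antipodeLin t).lTensor (Usu2 t) (comulHom t x)) =
      algebraMap ℂ _ (counitHom t x) := by
  induction x using induction with
  | hc c => simp [Algebra.TensorProduct.algebraMap_apply]
  | hg x =>
    have h0 := ne0 t
    cases x
    · change LinearMap.mul' ℂ (Usu2 t) ((antipodeLin t).lTensor (Usu2 t) (comulHom t (e t))) =
        algebraMap ℂ _ (counitHom t (e t))
      simp [e_mul_k]
    · change LinearMap.mul' ℂ (Usu2 t) ((antipodeLin t).lTensor (Usu2 t) (comulHom t (f t))) =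
        algebraMap ℂ _ (counitHom t (f t))
      simp [f_mul_k]
    · change LinearMap.mul' ℂ (Usu2 t) ((antipodeLin t).lTensor (Usu2 t) (comulHom t (k t))) =
        algebraMap ℂ _ (counitHom t (k t))
      simp [k_mul_kinv]
    · change LinearMap.mul' ℂ (Usu2 t) ((antipodeLin t).lTensor (Usu2 t) (comulHom t (kinv t))) =
        algebraMap ℂ _ (counitHom t (kinv t))
      simp [kinv_mul_k]
  | hm x y hx hy =>
    have key : ∀ z w : Usu2 t ⊗[ℂ] Usu2 t, ∀ c : ℂ,
        LinearMap.mul' ℂ (Usu2 t) ((antipodeLin t).lTensor (Usu2 t) z) = algebraMap ℂ _ c →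
        LinearMap.mul' ℂ (Usu2 t) ((antipodeLin t).lTensor (Usu2 t) (w * z)) =
          c • LinearMap.mul' ℂ (Usu2 t) ((antipodeLin t).lTensor (Usu2 t) w) := by
      intro z w c hz
      induction w with
      | zero => simp
      | add w w' h h' => simp only [add_mul, map_add, h, h', smul_add]
      | tmul a b =>
        have : ∀ z : Usu2 t ⊗[ℂ] Usu2 t,
            LinearMap.mul' ℂ (Usu2 t) ((antipodeLin t).lTensor (Usu2 t) (a ⊗ₜ b * z)) =
            a * LinearMap.mul' ℂ (Usu2 t) ((antipodeLin t).lTensor (Usu2 t) z) *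
              antipodeLin t b := by
          intro z
          induction z with
          | zero => simp
          | add z z' h h' => simp only [add_mul, map_add, h, h', mul_add]
          | tmul p q => simp [antipodeLin_mul, mul_assoc]
        rw [this, hz]
        simp [Algebra.algebraMap_eq_smul_one]
    rw [map_mul, key _ _ _ hy, hx, map_mul, map_mul, Algebra.smul_def,
      (Algebra.commutes _ _)]
  | ha x y hx hy => simp only [map_add, hx, hy]

instance : HopfAlgebra ℂ (Usu2 t) where
  antipode := antipodeLin t
  mul_antipode_rTensor_comul := LinearMap.ext (antipode_left t)
  mul_antipode_lTensor_comul := LinearMap.ext (antipode_right t)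

/-! ### The irreducible representations `(V^l, π^l)`

The spin `l ∈ {0, 1/2, 1, …}` is given by the natural number `a = 2l`. The weight basis vector
`e_m`, `m = -l, …, l`, is the standard basis vector with index `i = l + m ∈ {0, …, a}`; hence
`l - m = a - i` and `2m = 2i - a`. -/

/-- `[n] = (t^{2n} - t^{-2n}) / (t² - t⁻²)`. -/
def qInt (n : ℤ) : ℝ :=
  ((t : ℝ) ^ (2 * n) - (t : ℝ) ^ (-(2 * n))) / ((t : ℝ) ^ 2 - (t : ℝ) ^ (-2 : ℤ))

/-- The space `V^l` of dimension `2l + 1 = a + 1`. -/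
abbrev Spin (a : ℕ) : Type := Fin (a + 1) → ℂ

/-- The matrix of `e` in `V^l`: `e · e_m = ([l - m][l + m + 1])^{1/2} e_{m+1}`. -/
def matE (a : ℕ) : Matrix (Fin (a + 1)) (Fin (a + 1)) ℂ := Matrix.of fun i j =>
  if (i : ℕ) = (j : ℕ) + 1 then
    ((Real.sqrt (qInt t ((a : ℤ) - (j : ℕ)) * qInt t ((j : ℕ) + 1)) : ℝ) : ℂ) else 0

/-- The matrix of `f` in `V^l`: `f · e_m = ([l + m][l - m + 1])^{1/2} e_{m-1}`. -/
def matF (a : ℕ) : Matrix (Fin (a + 1)) (Fin (a + 1)) ℂ := Matrix.of fun i j =>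
  if (i : ℕ) + 1 = (j : ℕ) then
    ((Real.sqrt (qInt t (j : ℕ) * qInt t ((a : ℤ) - (j : ℕ) + 1)) : ℝ) : ℂ) else 0

/-- The matrix of `k` in `V^l`: `k · e_m = t^{2m} e_m`. -/
def matK (a : ℕ) : Matrix (Fin (a + 1)) (Fin (a + 1)) ℂ :=
  Matrix.diagonal fun i => ((t : ℝ) : ℂ) ^ (2 * ((i : ℕ) : ℤ) - a)

/-- The matrix of `k⁻¹` in `V^l`: `k⁻¹ · e_m = t^{-2m} e_m`. -/
def matKinv (a : ℕ) : Matrix (Fin (a + 1)) (Fin (a + 1)) ℂ :=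
  Matrix.diagonal fun i => ((t : ℝ) : ℂ) ^ (-(2 * ((i : ℕ) : ℤ) - a))

theorem qInt_nonneg {n : ℤ} (hn : 0 ≤ n) : 0 ≤ qInt t n := by
  have h0 : (t : ℝ) ≠ 0 := t.ne_zero
  have hq : 0 < (t : ℝ) ^ 2 := by positivity
  have e1 : (t : ℝ) ^ (2 * n) = ((t : ℝ) ^ 2) ^ n := by
    rw [zpow_mul]; norm_cast
  have e2 : (t : ℝ) ^ (-(2 * n)) = (((t : ℝ) ^ 2) ^ n)⁻¹ := by rw [zpow_neg, e1]
  have e3 : (t : ℝ) ^ (-2 : ℤ) = ((t : ℝ) ^ 2)⁻¹ := by rw [zpow_neg]; norm_cast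
  rw [qInt, e1, e2, e3]
  generalize (t : ℝ) ^ 2 = q at hq
  rcases le_total 1 q with h | h
  · have h1 : 1 ≤ q ^ n := one_le_zpow₀ h hn
    apply div_nonneg
    · have := inv_le_one_of_one_le₀ h1; linarith
    · have := inv_le_one_of_one_le₀ h; linarith
  · have h1 : q ^ n ≤ 1 := zpow_le_one₀ hq h hn
    apply div_nonneg_of_nonpos
    · have := (one_le_inv₀ (zpow_pos hq n)).2 h1; linarith
    · have := (one_le_inv₀ hq).2 h; linarith

theorem qInt_identity (x y : ℤ) :
    qInt t x * qInt t (y + 1) - qInt t y * qInt t (x + 1) =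
      ((t : ℝ) ^ 2 - (t : ℝ) ^ (-2 : ℤ))⁻¹ *
        (((t : ℝ) ^ (x - y)) ^ 2 - ((t : ℝ) ^ (-(x - y))) ^ 2) := by
  have h0 : (t : ℝ) ≠ 0 := t.ne_zero
  by_cases hd : (t : ℝ) ^ 2 - (t : ℝ) ^ (-2 : ℤ) = 0
  · simp only [qInt, hd]; simp
  simp only [qInt]
  rw [show 2 * (y + 1) = y + y + 2 by ring, show 2 * (x + 1) = x + x + 2 by ring,
    show 2 * x = x + x by ring, show 2 * y = y + y by ring]
  simp only [zpow_add₀ h0, zpow_neg, zpow_sub₀ h0, mul_inv] at hd ⊢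
  have hx : (t : ℝ) ^ x ≠ 0 := zpow_ne_zero _ h0
  have hy : (t : ℝ) ^ y ≠ 0 := zpow_ne_zero _ h0
  generalize (t : ℝ) ^ x = X at *
  generalize (t : ℝ) ^ y = Y at *
  have e3 : (t : ℝ) ^ (2 : ℤ) = (t : ℝ) ^ 2 := by norm_cast
  rw [e3] at hd ⊢
  have h2 : (t : ℝ) ^ 2 ≠ 0 := pow_ne_zero 2 h0
  generalize (t : ℝ) ^ 2 = q at *
  rw [div_mul_div_comm, div_mul_div_comm, ← sub_div, div_eq_iff (mul_ne_zero hd hd),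
    mul_comm ((q - q⁻¹)⁻¹), mul_assoc _ (q - q⁻¹)⁻¹, inv_mul_cancel_left₀ hd]
  field_simp
  ring

theorem matE_mul_matF (a : ℕ) : matE t a * matF t a =
    Matrix.diagonal fun i : Fin (a + 1) => ((qInt t (i : ℕ) * qInt t ((a : ℤ) - (i : ℕ) + 1) : ℝ) : ℂ) := by
  ext i j
  rw [Matrix.mul_apply]
  rcases Nat.eq_zero_or_pos (i : ℕ) with hi | hi
  · rw [Finset.sum_eq_zero]
    · rw [Matrix.diagonal_apply]
      split_ifs
      · simp [hi, qInt]
      · rfl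
    · intro x _
      simp [matE, hi]
  · have hlt : (i : ℕ) - 1 < a + 1 := by omega
    rw [Finset.sum_eq_single (⟨(i : ℕ) - 1, hlt⟩ : Fin (a + 1))]
    · have hsub : ((i : ℕ) - 1 : ℕ) + 1 = (i : ℕ) := by omega
      have hc : (((i : ℕ) - 1 : ℕ) : ℤ) = (i : ℕ) - 1 := by omega
      rw [Matrix.diagonal_apply]
      by_cases hij : i = j
      · subst hij
        have hnn : 0 ≤ qInt t (i : ℕ) * qInt t ((a : ℤ) - (i : ℕ) + 1) :=
          mul_nonneg (qInt_nonneg t (by omega)) (qInt_nonneg t (by omega))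
        simp only [matE, matF, Matrix.of_apply, hsub, hc, if_true]
        rw [show (a : ℤ) - (((i : ℕ) : ℤ) - 1) = (a : ℤ) - (i : ℕ) + 1 by ring,
          show ((i : ℕ) : ℤ) - 1 + 1 = (i : ℕ) by ring,
          mul_comm (qInt t ((a : ℤ) - (i : ℕ) + 1)), ← Complex.ofReal_mul,
          Real.mul_self_sqrt hnn]
      · have : (i : ℕ) ≠ (j : ℕ) := fun h => hij (Fin.ext h)
        simp [matE, matF, hsub, hij, this]
    · intro x _ hx
      have : (i : ℕ) ≠ (x : ℕ) + 1 := fun h => hx (Fin.ext (by simp; omega))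
      simp [matE, this]
    · simp

theorem matF_mul_matE (a : ℕ) : matF t a * matE t a =
    Matrix.diagonal fun i : Fin (a + 1) => ((qInt t ((a : ℤ) - (i : ℕ)) * qInt t ((i : ℕ) + 1) : ℝ) : ℂ) := by
  ext i j
  rw [Matrix.mul_apply]
  rcases Nat.lt_or_ge (i : ℕ) a with hi | hi
  · have hlt : (i : ℕ) + 1 < a + 1 := by omega
    rw [Finset.sum_eq_single (⟨(i : ℕ) + 1, hlt⟩ : Fin (a + 1))]
    · rw [Matrix.diagonal_apply]
      by_cases hij : i = j
      · subst hij
        have hnn : 0 ≤ qInt t ((a : ℤ) - (i : ℕ)) * qInt t ((i : ℕ) + 1) :=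
          mul_nonneg (qInt_nonneg t (by omega)) (qInt_nonneg t (by omega))
        simp only [matE, matF, Matrix.of_apply, if_true, Nat.cast_add, Nat.cast_one]
        rw [show (a : ℤ) - (((i : ℕ) : ℤ) + 1) + 1 = (a : ℤ) - (i : ℕ) by ring,
          mul_comm (qInt t (((i : ℕ) : ℤ) + 1)), ← Complex.ofReal_mul,
          Real.mul_self_sqrt hnn]
      · have : (i : ℕ) ≠ (j : ℕ) := fun h => hij (Fin.ext h)
        simp [matE, matF, hij, this]
    · intro x _ hx
      have : (i : ℕ) + 1 ≠ (x : ℕ) := fun h => hx (Fin.ext h.symm)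
      simp [matF, this]
    · simp
  · have hia : (i : ℕ) = a := by omega
    rw [Finset.sum_eq_zero]
    · rw [Matrix.diagonal_apply]
      split_ifs
      · simp [hia, qInt]
      · rfl
    · intro x _
      have : (i : ℕ) + 1 ≠ (x : ℕ) := by omega
      simp [matF, this]

/-- The representation of `U_t(su(2))` on `V^l` by matrices. -/
def matRep (a : ℕ) : Usu2 t →ₐ[ℂ] Matrix (Fin (a + 1)) (Fin (a + 1)) ℂ :=
  lift (matE t a) (matF t a) (matK t a) (matKinv t a)
    (by
      have h0 := ne0 t
      rw [matK, matKinv, Matrix.diagonal_mul_diagonal, ← Matrix.diagonal_one]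
      congr 1; ext i
      rw [← zpow_add₀ h0]; simp)
    (by
      have h0 := ne0 t
      rw [matK, matKinv, Matrix.diagonal_mul_diagonal, ← Matrix.diagonal_one]
      congr 1; ext i
      rw [← zpow_add₀ h0]; simp)
    (by
      have h0 := ne0 t
      ext i j
      rw [matK, Matrix.diagonal_mul, Matrix.smul_apply, Matrix.mul_diagonal, smul_eq_mul]
      simp only [matE, Matrix.of_apply]
      split_ifs with h
      · rw [h, show (2 * (((j : ℕ) + 1 : ℕ) : ℤ) - a) = 2 + (2 * ((j : ℕ) : ℤ) - a) by
          push_cast; ring, zpow_add₀ h0,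
          show ((t : ℝ) : ℂ) ^ (2 : ℤ) = ((t : ℝ) : ℂ) ^ 2 from zpow_natCast _ 2]
        ring
      · simp)
    (by
      have h0 := ne0 t
      ext i j
      rw [matK, Matrix.diagonal_mul, Matrix.smul_apply, Matrix.mul_diagonal, smul_eq_mul]
      simp only [matF, Matrix.of_apply]
      split_ifs with h
      · rw [← h, show (2 * ((i : ℕ) : ℤ) - a) = -2 + (2 * (((i : ℕ) + 1 : ℕ) : ℤ) - a) by
          push_cast; ring, zpow_add₀ h0]
        ring
      · simp)
    (by
      rw [matE_mul_matF, matF_mul_matE, matK, matKinv, Matrix.diagonal_pow, Matrix.diagonal_pow,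
        Matrix.diagonal_sub, Matrix.diagonal_sub, ← Matrix.diagonal_smul]
      congr 1; ext i
      have h := qInt_identity t (i : ℕ) ((a : ℤ) - (i : ℕ))
      rw [show ((i : ℕ) : ℤ) - ((a : ℤ) - (i : ℕ)) = 2 * ((i : ℕ) : ℤ) - a by ring] at h
      have h' := congrArg (fun x : ℝ => (x : ℂ)) h
      push_cast at h'
      simp only [Pi.smul_apply, Pi.pow_apply, smul_eq_mul]
      push_cast
      exact h')

/-- The irreducible representation `(V^l, π^l)` of spin `l = a / 2`. -/
def spinRep (a : ℕ) : Usu2 t →ₐ[ℂ] Module.End ℂ (Spin a) :=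
  (Matrix.toLinAlgEquiv' (R := ℂ) (n := Fin (a + 1))).toAlgHom.comp (matRep t a)

/-! ### Clebsch–Gordan coefficients -/

/-- The values of `2j` for `j = |k - l|, |k - l| + 1, …, k + l`, where `a = 2k` and `b = 2l`. -/
def cgSpins (a b : ℕ) : Finset ℕ :=
  (Finset.Icc ((a : ℤ) - b).natAbs (a + b)).filter fun c => Even (a + b + c)

/-- A Clebsch–Gordan decomposition `V^k ⊗ V^l = ⨁_{j = |k - l|}^{k + l} V^j`, that is, an
isomorphism of representations between the two sides (`a = 2k`, `b = 2l`). -/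
structure CGDecomposition (a b : ℕ) where
  /-- The isomorphism. -/
  iso : Spin a ⊗[ℂ] Spin b ≃ₗ[ℂ] ((c : cgSpins a b) → Spin c)
  map_rep : ∀ (x : Usu2 t) (w : Spin a ⊗[ℂ] Spin b) (c : cgSpins a b),
    iso (tensorRep (spinRep t a) (spinRep t b) x w) c = spinRep t c x (iso w c)

variable {t} in
/-- The Clebsch–Gordan coefficient `(kp, ln | jm)_t` of a decomposition: the coefficient of
`e_m^j` in `e_p^k ⊗ e_n^l`, and zero when `V^j` does not occur in `V^k ⊗ V^l`. Here `c = 2j`. -/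
def CGDecomposition.coeff {a b : ℕ} (D : CGDecomposition t a b) (c : ℕ)
    (p : Fin (a + 1)) (n : Fin (b + 1)) (m : Fin (c + 1)) : ℂ :=
  if h : c ∈ cgSpins a b then
    D.iso ((Pi.single p 1 : Spin a) ⊗ₜ[ℂ] (Pi.single n 1 : Spin b)) ⟨c, h⟩ m
  else 0

end Usu2
end

/-!
A tensor operator `T` is the same thing as a homomorphism of representations
`V^k ⊗ V^l → V^j`, `v ⊗ w ↦ T(v) w`: by coassociativity
`∑ T(a⁽¹⁾ v)(a⁽²⁾ w) = ∑ a⁽¹⁾ T(v)(S(a⁽²⁾) a⁽³⁾ w)`, and the antipode cancels the last two legs.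
Transported through an isomorphism `V^k ⊗ V^l ≅ ⨁ V^i`, it is by Schur's lemma a multiple `α` of the
projection to `V^j`, whose matrix elements are the Clebsch–Gordan coefficients.

The decomposition itself comes from the vectors `∑_{p + q = s} (-t^{-(c + 2)})^p e^p x ⊗ e^q y`,
where `x` and `y` are the lowest weight vectors of `V^k` and `V^l`. They are highest weight vectors,
one for each weight `c = 2i`, and their `f`-strings are copies of the `V^i`. The sum of the
resulting maps `V^i → V^k ⊗ V^l` is injective because it is so on the kernel of the nilpotent
operator `e`, and it is bijective by a dimension count. Everything in this construction is fixed by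
complex conjugation, so the coefficients are real.
-/

noncomputable section

/-! ### Hopf algebras, representations and tensor operators -/

section Hopf

variable {R A : Type*} [CommSemiring R] [Semiring A] [HopfAlgebra R A]

open LinearMap in
theorem lTensor_mul_antipode_comul (a : A) :
    lTensor A (mul' R A ∘ₗ rTensor A (HopfAlgebra.antipode R))
      (TensorProduct.assoc R A A A (rTensor A Coalgebra.comul (Coalgebra.comul a))) =
    a ⊗ₜ[R] 1 := by
  rw [Coalgebra.coassoc_apply, ← comp_apply, ← lTensor_comp, comp_assoc,
    HopfAlgebra.mul_antipode_rTensor_comul, lTensor_comp, comp_apply,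
    Coalgebra.lTensor_counit_comul]
  simp

end Hopf

section Intertwining

variable {R A : Type*} [CommSemiring R] [Semiring A] [Algebra R A]
variable {M N P : Type*} [AddCommMonoid M] [Module R M] [AddCommMonoid N] [Module R N]
  [AddCommMonoid P] [Module R P]

/-- `φ` is a homomorphism of representations from `(M, σ)` to `(N, τ)`. -/
def IsIntertwining (σ : A →ₐ[R] Module.End R M) (τ : A →ₐ[R] Module.End R N)
    (φ : M →ₗ[R] N) : Prop :=
  ∀ a x, φ (σ a x) = τ a (φ x)

/-- The direct product of a family of representations. -/
def piRep {ι : Type*} {M : ι → Type*} [∀ i, AddCommMonoid (M i)] [∀ i, Module R (M i)]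
    (σ : ∀ i, A →ₐ[R] Module.End R (M i)) : A →ₐ[R] Module.End R (∀ i, M i) :=
  AlgHom.ofLinearMap
    { toFun := fun a => LinearMap.piMap fun i => σ i a
      map_add' := fun a b => by ext; simp
      map_smul' := fun r a => by ext; simp }
    (by ext; simp) (fun a b => by ext; simp)

namespace IsIntertwining

variable {σ : A →ₐ[R] Module.End R M} {τ : A →ₐ[R] Module.End R N} {υ : A →ₐ[R] Module.End R P}

theorem comp {ψ : N →ₗ[R] P} {φ : M →ₗ[R] N} (hψ : IsIntertwining τ υ ψ)
    (hφ : IsIntertwining σ τ φ) : IsIntertwining σ υ (ψ ∘ₗ φ) :=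
  fun a x => by simp only [LinearMap.comp_apply, hφ a, hψ a]

theorem symm {φ : M ≃ₗ[R] N} (hφ : IsIntertwining σ τ φ.toLinearMap) :
    IsIntertwining τ σ φ.symm.toLinearMap :=
  fun a x => φ.injective (by simpa using! (hφ a (φ.symm x)).symm)

end IsIntertwining

section Pi

variable {ι : Type*} {M : ι → Type*} [∀ i, AddCommMonoid (M i)] [∀ i, Module R (M i)]
  (σ : ∀ i, A →ₐ[R] Module.End R (M i))

@[simp] theorem piRep_apply (a : A) (x : ∀ i, M i) (i : ι) : piRep σ a x i = σ i a (x i) := rfl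

theorem piRep_single [DecidableEq ι] (a : A) (i : ι) (x : M i) :
    piRep σ a (Pi.single i x) = Pi.single i (σ i a x) := by
  ext j
  obtain rfl | h := eq_or_ne j i <;> simp_all

theorem isIntertwining_single [DecidableEq ι] (i : ι) :
    IsIntertwining (σ i) (piRep σ) (LinearMap.single R M i) :=
  fun a x => (piRep_single σ a i x).symm

theorem isIntertwining_lsum [Fintype ι] [DecidableEq ι] {τ : A →ₐ[R] Module.End R N}
    {φ : ∀ i, M i →ₗ[R] N} (h : ∀ i, IsIntertwining (σ i) τ (φ i)) :
    IsIntertwining (piRep σ) τ (LinearMap.lsum R M R φ) :=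
  fun a x => by simp [LinearMap.lsum_apply, h _ a]

end Pi

end Intertwining

section LinearAlgebra

theorem injective_of_comp_eq_of_ker {R M N : Type*} [Ring R] [AddCommGroup M] [Module R M]
    [AddCommGroup N] [Module R N] {φ : M →ₗ[R] N} {E : Module.End R M} {E' : Module.End R N}
    (hcomp : ∀ x, φ (E x) = E' (φ x)) (hnil : ∀ x, ∃ n : ℕ, (E ^ n) x = 0)
    (hker : ∀ x, E x = 0 → φ x = 0 → x = 0) : Function.Injective φ := by
  refine (injective_iff_map_eq_zero φ).2 fun x hx => ?_
  obtain ⟨n, hn⟩ := hnil x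
  induction n generalizing x with
  | zero => simpa using hn
  | succ n ih =>
    refine hker x (ih (E x) (by rw [hcomp, hx, map_zero]) ?_) hx
    rwa [← Module.End.mul_apply, ← pow_succ]

theorem star_pow_apply {R N : Type*} [Semiring R] [AddCommMonoid N] [Module R N] [Star N]
    {F : Module.End R N} (hF : ∀ x, star (F x) = F (star x)) (n : ℕ) (x : N) :
    star ((F ^ n) x) = (F ^ n) (star x) := by
  simpa only [Module.End.pow_apply] using Function.Semiconj.iterate_right hF n x

theorem exists_eq_mul_and_im_eq_zero {ι : Type*} {f g : ι → ℂ} (h : ∃ α : ℂ, ∀ i, f i = α * g i) :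
    ∃ α : ℂ, (∀ i, f i = α * g i) ∧ ((∀ i, (g i).im = 0 ∧ (f i).im = 0) → α.im = 0) := by
  obtain ⟨α, hα⟩ := h
  by_cases hg : ∀ i, g i = 0
  · exact ⟨0, fun i => by rw [hα, hg, mul_zero, mul_zero], fun _ => Complex.zero_im⟩
  · obtain ⟨i, hi⟩ := not_forall.1 hg
    refine ⟨α, hα, fun hreal => ?_⟩
    obtain ⟨hgi, hfi⟩ := hreal i
    rw [eq_div_of_mul_eq hi (hα i).symm, ← Complex.conj_eq_iff_im, map_div₀,
      Complex.conj_eq_iff_im.2 hgi, Complex.conj_eq_iff_im.2 hfi]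

end LinearAlgebra

section TensorOperator

variable {A : Type*} [Ring A] [HopfAlgebra ℂ A]
variable {V W U : Type*} [AddCommGroup V] [Module ℂ V] [AddCommGroup W] [Module ℂ W]
  [AddCommGroup U] [Module ℂ U]
variable {π : A →ₐ[ℂ] Module.End ℂ V} {ρ : A →ₐ[ℂ] Module.End ℂ W} {σ : A →ₐ[ℂ] Module.End ℂ U}

/-- The linear map `A ⊗ A → U`, `a ⊗ b ↦ σ(a) g(ρ(b) w)`. Evaluated at `∑ a⁽¹⁾ ⊗ S(a⁽²⁾)`, it gives
the action of `a` on `g ∈ Hom(W, U)`. -/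
def sandwich (ρ : A →ₐ[ℂ] Module.End ℂ W) (σ : A →ₐ[ℂ] Module.End ℂ U) (g : W →ₗ[ℂ] U) (w : W) :
    A ⊗[ℂ] A →ₗ[ℂ] U :=
  TensorProduct.lift (LinearMap.mk₂ ℂ (fun a b => σ a (g (ρ b w)))
    (by simp) (by simp) (by simp) (by simp))

theorem homRep_apply_apply (a b : A) (g : W →ₗ[ℂ] U) (w : W) :
    homRep ρ σ a g (ρ b w) = sandwich ρ σ g w
      (LinearMap.lTensor A (LinearMap.mul' ℂ A ∘ₗ LinearMap.rTensor A (HopfAlgebra.antipode ℂ))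
        (TensorProduct.assoc ℂ A A A (Coalgebra.comul a ⊗ₜ[ℂ] b))) := by
  simp only [homRep, LinearMap.comp_apply]
  induction Coalgebra.comul (R := ℂ) a with
  | zero => simp
  | add x y hx hy => simp only [map_add, LinearMap.add_apply, TensorProduct.add_tmul, hx, hy]
  | tmul x y => simp [sandwich]

theorem tensorRep_apply_tmul (a : A) (v : V) (w : W) :
    tensorRep π ρ a (v ⊗ₜ w) = TensorProduct.map (π.toLinearMap.flip v) (ρ.toLinearMap.flip w)
      (Coalgebra.comul a) := by
  change Module.endTensorEndAlgHom (R := ℂ) (A := ℂ)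
    (TensorProduct.map π.toLinearMap ρ.toLinearMap (Coalgebra.comul a)) (v ⊗ₜ w) = _
  induction Coalgebra.comul (R := ℂ) a with
  | zero => simp
  | add x y hx hy => simp only [map_add, LinearMap.add_apply, hx, hy]
  | tmul x y => exact TensorProduct.map_tmul ..

theorem IsTensorOperator.isIntertwining_lift {T : V →ₗ[ℂ] W →ₗ[ℂ] U}
    (hT : IsTensorOperator π ρ σ T) :
    IsIntertwining (tensorRep π ρ) σ (TensorProduct.lift T) := by
  intro a x
  induction x with
  | zero => simp
  | add x y hx hy => simp only [map_add, hx, hy]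
  | tmul v w =>
    have legs (z : A ⊗[ℂ] A) :
        TensorProduct.lift T
          (TensorProduct.map (π.toLinearMap.flip v) (ρ.toLinearMap.flip w) z) =
        sandwich ρ σ (T v) w (LinearMap.lTensor A
          (LinearMap.mul' ℂ A ∘ₗ LinearMap.rTensor A (HopfAlgebra.antipode ℂ))
          (TensorProduct.assoc ℂ A A A (LinearMap.rTensor A Coalgebra.comul z))) := by
      induction z with
      | zero => simp
      | add x y hx hy => simp only [map_add, hx, hy]
      | tmul b c =>
        have hTb : T (π b v) = homRep ρ σ b (T v) := LinearMap.congr_fun (hT b) v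
        simpa [hTb] using! homRep_apply_apply b c (T v) w
    rw [tensorRep_apply_tmul, legs, lTensor_mul_antipode_comul]
    simp [sandwich]

end TensorOperator

namespace Usu2

open Finset.HasAntidiagonal (antidiagonal mem_antidiagonal)

variable {t : ℝˣ}

/-! ### Quantum integers -/

theorem zpow_injective (ht : (t : ℝ) ^ 2 ≠ 1) : Function.Injective fun n : ℤ => (t : ℝ) ^ n := by
  refine Function.Injective.of_comp (f := fun x : ℝ => x ^ 2) ?_
  have comp_eq : (fun x : ℝ => x ^ 2) ∘ (fun n : ℤ => (t : ℝ) ^ n) = fun n => ((t : ℝ) ^ 2) ^ n :=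
    funext fun n => by rw [Function.comp_apply, ← zpow_natCast, ← zpow_natCast, zpow_comm]
  exact comp_eq ▸ zpow_right_injective₀ (sq_pos_of_ne_zero t.ne_zero) ht

theorem ofReal_zpow_injective (ht : (t : ℝ) ^ 2 ≠ 1) :
    Function.Injective fun n : ℤ => ((t : ℝ) : ℂ) ^ n :=
  fun m n h => zpow_injective ht (Complex.ofReal_injective (by simpa using h))

@[simp] theorem qInt_zero : qInt t 0 = 0 := by simp [qInt]

theorem qInt_ne_zero (ht : (t : ℝ) ^ 2 ≠ 1) {n : ℤ} (hn : n ≠ 0) : qInt t n ≠ 0 := by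
  have sub_ne_zero_of_ne_neg {m : ℤ} (hm : m ≠ -m) : (t : ℝ) ^ m - (t : ℝ) ^ (-m) ≠ 0 :=
    sub_ne_zero.2 ((zpow_injective ht).ne hm)
  refine div_ne_zero (sub_ne_zero_of_ne_neg (by omega)) ?_
  exact_mod_cast sub_ne_zero_of_ne_neg (m := 2) (by decide)

theorem qInt_pos (ht : (t : ℝ) ^ 2 ≠ 1) {n : ℤ} (hn : 0 < n) : 0 < qInt t n :=
  (qInt_nonneg t hn.le).lt_of_ne' (qInt_ne_zero ht hn.ne')

theorem qInt_mul_sub_qInt_mul (x y : ℤ) :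
    qInt t x * qInt t (y + 1) - qInt t y * qInt t (x + 1) = qInt t (x - y) := by
  rw [qInt_identity, qInt, div_eq_inv_mul]
  simp only [← zpow_natCast, ← zpow_mul]
  ring_nf

/-- The matrix element `([c - i][i + 1])^{1/2}` of `e` between the weight vectors `i` and
`i + 1` of `Spin c`, and of `f` between `i + 1` and `i`. -/
def ladder (t : ℝˣ) (c i : ℕ) : ℝ := √(qInt t (c - i) * qInt t (i + 1))

@[simp] theorem ladder_self (c : ℕ) : ladder t c c = 0 := by simp [ladder]

theorem ladder_mul_self {c i : ℕ} (h : i ≤ c) :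
    ladder t c i * ladder t c i = qInt t (c - i) * qInt t (i + 1) :=
  Real.mul_self_sqrt (mul_nonneg (qInt_nonneg t (by omega)) (qInt_nonneg t (by omega)))

theorem ladder_ne_zero (ht : (t : ℝ) ^ 2 ≠ 1) {c i : ℕ} (h : i < c) : ladder t c i ≠ 0 :=
  (Real.sqrt_pos.2 (mul_pos (qInt_pos ht (by omega)) (qInt_pos ht (by omega)))).ne'

theorem ladder_comm {c i j : ℕ} (h : i + j + 1 = c) : ladder t c i = ladder t c j := by
  subst h
  simp only [ladder]
  push_cast
  ring_nf

/-! ### Weight spaces -/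

section Weight

variable {N : Type*} [AddCommGroup N] [Module ℂ N]

/-- The space of vectors of weight `r`, that is, on which `k` acts as `t ^ r`. In `V^l` the vector
`e_m` has weight `2m`. -/
def weightSpace (σ : Usu2 t →ₐ[ℂ] Module.End ℂ N) (r : ℤ) : Submodule ℂ N :=
  Module.End.eigenspace (σ (k t)) (((t : ℝ) : ℂ) ^ r)

variable {σ : Usu2 t →ₐ[ℂ] Module.End ℂ N} {r : ℤ} {x : N}

theorem mem_weightSpace : x ∈ weightSpace σ r ↔ σ (k t) x = ((t : ℝ) : ℂ) ^ r • x :=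
  Module.End.mem_eigenspace_iff

theorem weight_unique (ht : (t : ℝ) ^ 2 ≠ 1) {s : ℤ} (hx : x ≠ 0) (hr : x ∈ weightSpace σ r)
    (hs : x ∈ weightSpace σ s) : r = s :=
  ofReal_zpow_injective ht (smul_left_injective ℂ hx
    ((mem_weightSpace.1 hr).symm.trans (mem_weightSpace.1 hs)))

theorem kinv_apply_of_mem_weightSpace (hx : x ∈ weightSpace σ r) :
    σ (kinv t) x = ((t : ℝ) : ℂ) ^ (-r) • x := by
  have hinv : σ (kinv t) (σ (k t) x) = x := by
    rw [← Module.End.mul_apply, ← map_mul, kinv_mul_k, map_one, Module.End.one_apply]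
  rw [mem_weightSpace.1 hx, map_smul] at hinv
  rw [zpow_neg, eq_inv_smul_iff₀ (zpow_ne_zero _ (ne0 t)), hinv]

theorem e_apply_mem_weightSpace (hx : x ∈ weightSpace σ r) :
    σ (e t) x ∈ weightSpace σ (r + 2) := by
  rw [mem_weightSpace, ← Module.End.mul_apply, ← map_mul, k_mul_e, map_smul, map_mul,
    LinearMap.smul_apply, Module.End.mul_apply, mem_weightSpace.1 hx, map_smul, smul_smul,
    zpow_add₀ (ne0 t), mul_comm]
  norm_cast

theorem f_apply_mem_weightSpace (hx : x ∈ weightSpace σ r) :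
    σ (f t) x ∈ weightSpace σ (r - 2) := by
  rw [mem_weightSpace, ← Module.End.mul_apply, ← map_mul, k_mul_f, map_smul, map_mul,
    LinearMap.smul_apply, Module.End.mul_apply, mem_weightSpace.1 hx, map_smul, smul_smul,
    sub_eq_add_neg, zpow_add₀ (ne0 t), mul_comm]

theorem e_f_apply_sub_f_e_apply (hx : x ∈ weightSpace σ r) :
    σ (e t) (σ (f t) x) - σ (f t) (σ (e t) x) = (qInt t r : ℂ) • x := by
  have h := LinearMap.congr_fun (congrArg σ (e_mul_f_sub t)) x
  simp only [map_sub, map_mul, map_smul, LinearMap.sub_apply, LinearMap.smul_apply,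
    Module.End.mul_apply, pow_two, mem_weightSpace.1 hx, kinv_apply_of_mem_weightSpace hx,
    smul_smul, ← sub_smul] at h
  rw [h, qInt, div_eq_inv_mul, two_mul, neg_add, zpow_add₀ t.ne_zero, zpow_add₀ t.ne_zero]
  simp only [pow_two]
  push_cast
  rfl

variable {M : Type*} [AddCommGroup M] [Module ℂ M] {τ : Usu2 t →ₐ[ℂ] Module.End ℂ M}

theorem isIntertwining_of_e_f_k {φ : M →ₗ[ℂ] N} (he : ∀ x, φ (τ (e t) x) = σ (e t) (φ x))
    (hf : ∀ x, φ (τ (f t) x) = σ (f t) (φ x)) (hk : ∀ x, φ (τ (k t) x) = σ (k t) (φ x)) :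
    IsIntertwining τ σ φ := by
  intro a
  induction a using induction with
  | hc c => simp [Algebra.algebraMap_eq_smul_one]
  | ha a b h1 h2 => simp [h1, h2]
  | hm a b h1 h2 => simp [h1, h2]
  | hg g =>
    cases g with
    | e => exact he
    | f => exact hf
    | k => exact hk
    | kinv =>
      intro x
      have k_kinv (x : M) : τ (k t) (τ (kinv t) x) = x := by
        rw [← Module.End.mul_apply, ← map_mul, k_mul_kinv, map_one, Module.End.one_apply]
      have kinv_k (y : N) : σ (kinv t) (σ (k t) y) = y := by
        rw [← Module.End.mul_apply, ← map_mul, kinv_mul_k, map_one, Module.End.one_apply]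
      rw [← kinv_k (φ (τ (gen t Gen.kinv) x)), ← hk, k_kinv]

theorem apply_mem_weightSpace_of_isIntertwining {φ : M →ₗ[ℂ] N} (hφ : IsIntertwining τ σ φ) {y : M}
    (hy : y ∈ weightSpace τ r) : φ y ∈ weightSpace σ r := by
  rw [mem_weightSpace, ← hφ, mem_weightSpace.1 hy, map_smul]

theorem comul_eq_comulHom (a : Usu2 t) : Coalgebra.comul (R := ℂ) a = comulHom t a := rfl

theorem tensorRep_e_tmul_of_mem_weightSpace {y : M} {s : ℤ} (hx : x ∈ weightSpace σ r)
    (hy : y ∈ weightSpace τ s) :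
    tensorRep σ τ (e t) (x ⊗ₜ y) =
      ((t : ℝ) : ℂ) ^ (-s) • (σ (e t) x ⊗ₜ y) + ((t : ℝ) : ℂ) ^ r • (x ⊗ₜ τ (e t) y) := by
  simp [tensorRep_apply_tmul, comul_eq_comulHom, mem_weightSpace.1 hx,
    kinv_apply_of_mem_weightSpace hy, TensorProduct.smul_tmul']

theorem tmul_mem_weightSpace {y : M} {s : ℤ} (hx : x ∈ weightSpace σ r)
    (hy : y ∈ weightSpace τ s) : x ⊗ₜ y ∈ weightSpace (tensorRep σ τ) (r + s) := by
  rw [mem_weightSpace, tensorRep_apply_tmul, comul_eq_comulHom, comulHom_k,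
    TensorProduct.map_tmul, LinearMap.flip_apply, LinearMap.flip_apply,
    AlgHom.toLinearMap_apply, AlgHom.toLinearMap_apply, mem_weightSpace.1 hx, mem_weightSpace.1 hy,
    TensorProduct.smul_tmul_smul, zpow_add₀ (ne0 t)]

end Weight

/-! ### The weight basis -/

/-- The weight vector with index `n` of `Spin a`, read as zero when `a < n`, so that the ladder
relations hold for every `n`. -/
def weightVec (a n : ℕ) : Spin a := fun i => if (i : ℕ) = n then 1 else 0

theorem weightVec_val {a : ℕ} (i : Fin (a + 1)) : weightVec a i = Pi.single i 1 := by
  ext j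
  simp [weightVec, Pi.single_apply, Fin.ext_iff]

theorem weightVec_of_le {a n : ℕ} (h : n ≤ a) :
    weightVec a n = Pi.single ⟨n, Nat.lt_succ_of_le h⟩ 1 :=
  weightVec_val ⟨n, Nat.lt_succ_of_le h⟩

theorem weightVec_of_lt {a n : ℕ} (h : a < n) : weightVec a n = 0 := by
  ext i
  simp [weightVec, show (i : ℕ) ≠ n by omega]

theorem linearMap_ext_weightVec {a : ℕ} {N : Type*} [AddCommGroup N] [Module ℂ N]
    {φ ψ : Spin a →ₗ[ℂ] N} (h : ∀ n ≤ a, φ (weightVec a n) = ψ (weightVec a n)) : φ = ψ := by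
  ext i
  simpa [weightVec_val] using h i i.is_le

theorem spinRep_apply (a : ℕ) (x : Usu2 t) : spinRep t a x = (matRep t a x).mulVecLin := rfl

theorem spinRep_e_weightVec (a n : ℕ) :
    spinRep t a (e t) (weightVec a n) = (ladder t a n : ℂ) • weightVec a (n + 1) := by
  obtain h | h := le_or_gt n a
  · ext i
    simp [weightVec_of_le h, spinRep_apply, matRep, matE, ladder, weightVec]
  · simp [weightVec_of_lt h, weightVec_of_lt (h.trans n.lt_succ_self)]

@[simp] theorem spinRep_f_weightVec_zero (a : ℕ) : spinRep t a (f t) (weightVec a 0) = 0 := by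
  ext i
  simp [weightVec_of_le a.zero_le, spinRep_apply, matRep, matF]

theorem spinRep_f_weightVec_succ (a n : ℕ) :
    spinRep t a (f t) (weightVec a (n + 1)) = (ladder t a n : ℂ) • weightVec a n := by
  obtain h | rfl | h := lt_trichotomy n a
  · ext i
    simp [weightVec_of_le (Nat.succ_le_of_lt h), spinRep_apply, matRep, matF, ladder, weightVec,
      mul_comm (qInt t (n + 1)), show (a : ℤ) - (n + 1) + 1 = a - n by ring]
  · simp [weightVec_of_lt n.lt_succ_self]
  · simp [weightVec_of_lt h, weightVec_of_lt (h.trans n.lt_succ_self)]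

theorem weightVec_mem_weightSpace (a n : ℕ) :
    weightVec a n ∈ weightSpace (spinRep t a) (2 * n - a) := by
  rw [mem_weightSpace]
  ext i
  obtain hi | hi := eq_or_ne (i : ℕ) n <;>
    simp [weightVec, spinRep_apply, matRep, matK, hi, Matrix.mulVec_diagonal]

theorem weightVec_self_mem_weightSpace (a : ℕ) :
    weightVec a a ∈ weightSpace (spinRep t a) a := by
  simpa [two_mul] using weightVec_mem_weightSpace (t := t) a a

theorem spinRep_e_apply_succ (a : ℕ) (x : Spin a) (i : Fin a) :
    spinRep t a (e t) x i.succ = (ladder t a i : ℂ) * x i.castSucc := by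
  rw [spinRep_apply, Matrix.mulVecLin_apply, Matrix.mulVec, dotProduct,
    Fintype.sum_eq_single i.castSucc]
  · simp [matRep, matE, ladder]
  · intro j hj
    have hji : ¬(i : ℕ) = j := fun h => hj (Fin.ext h.symm)
    simp [matRep, matE, hji]

theorem eq_smul_weightVec_of_e_apply_eq_zero (ht : (t : ℝ) ^ 2 ≠ 1) {a : ℕ} {x : Spin a}
    (hx : spinRep t a (e t) x = 0) : x = x (Fin.last a) • weightVec a a := by
  ext i
  induction i using Fin.lastCases with
  | last => simp [weightVec]
  | cast i =>
    have hi : (ladder t a i : ℂ) * x i.castSucc = 0 := by rw [← spinRep_e_apply_succ, hx]; rfl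
    have hx0 : x i.castSucc = 0 :=
      (mul_eq_zero.1 hi).resolve_left (Complex.ofReal_ne_zero.2 (ladder_ne_zero ht i.is_lt))
    simp [hx0, weightVec, i.is_lt.ne]

theorem spinRep_e_pow_weightVec {a n i : ℕ} (h : a < i + n) :
    (spinRep t a (e t) ^ n) (weightVec a i) = 0 := by
  induction n generalizing i with
  | zero => simpa using weightVec_of_lt h
  | succ n ih =>
    rw [pow_succ, Module.End.mul_apply, spinRep_e_weightVec, map_smul, ih (by omega), smul_zero]

theorem spinRep_e_pow_eq_zero {a n : ℕ} (h : a < n) : spinRep t a (e t) ^ n = 0 :=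
  linearMap_ext_weightVec fun i _ => spinRep_e_pow_weightVec (by omega)

/-! ### Homomorphisms out of `V^l` -/

section Schur

variable {N : Type*} [AddCommGroup N] [Module ℂ N] {σ : Usu2 t →ₐ[ℂ] Module.End ℂ N}

theorem isIntertwining_of_weightVec {c : ℕ} {φ : Spin c →ₗ[ℂ] N}
    (he : ∀ n ≤ c, φ (spinRep t c (e t) (weightVec c n)) = σ (e t) (φ (weightVec c n)))
    (hf : ∀ n ≤ c, φ (spinRep t c (f t) (weightVec c n)) = σ (f t) (φ (weightVec c n)))
    (hk : ∀ n ≤ c, φ (weightVec c n) ∈ weightSpace σ (2 * n - c)) :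
    IsIntertwining (spinRep t c) σ φ := by
  have of_weightVec {a : Usu2 t}
      (h : ∀ n ≤ c, φ (spinRep t c a (weightVec c n)) = σ a (φ (weightVec c n))) (x : Spin c) :
      φ (spinRep t c a x) = σ a (φ x) :=
    LinearMap.congr_fun (f := φ ∘ₗ spinRep t c a) (g := σ a ∘ₗ φ) (linearMap_ext_weightVec h) x
  refine isIntertwining_of_e_f_k (of_weightVec he) (of_weightVec hf) (of_weightVec fun n hn => ?_)
  rw [mem_weightSpace.1 (weightVec_mem_weightSpace c n), map_smul, mem_weightSpace.1 (hk n hn)]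

theorem linearMap_ext_of_f_comm (ht : (t : ℝ) ^ 2 ≠ 1) {c : ℕ} {F : Module.End ℂ N}
    {φ ψ : Spin c →ₗ[ℂ] N} (hφ : ∀ x, φ (spinRep t c (f t) x) = F (φ x))
    (hψ : ∀ x, ψ (spinRep t c (f t) x) = F (ψ x))
    (htop : φ (weightVec c c) = ψ (weightVec c c)) : φ = ψ := by
  refine linearMap_ext_weightVec fun n hn => ?_
  induction hn using Nat.decreasingInduction with
  | self => exact htop
  | of_succ n hn ih =>
    have hl : (ladder t c n : ℂ) ≠ 0 := Complex.ofReal_ne_zero.2 (ladder_ne_zero ht hn)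
    refine smul_right_injective N hl ?_
    simp only [← map_smul, ← spinRep_f_weightVec_succ, hφ, hψ, ih]

theorem isIntertwining_apply_weightVec_self (ht : (t : ℝ) ^ 2 ≠ 1) {c j : ℕ}
    {φ : Spin c →ₗ[ℂ] Spin j} (hφ : IsIntertwining (spinRep t c) (spinRep t j) φ) :
    φ (weightVec c c) = φ (weightVec c c) (Fin.last j) • weightVec j j := by
  refine eq_smul_weightVec_of_e_apply_eq_zero ht ?_
  rw [← hφ, spinRep_e_weightVec, ladder_self, Complex.ofReal_zero, zero_smul, map_zero]

theorem exists_eq_smul_id_of_isIntertwining (ht : (t : ℝ) ^ 2 ≠ 1) {c : ℕ}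
    {φ : Spin c →ₗ[ℂ] Spin c} (hφ : IsIntertwining (spinRep t c) (spinRep t c) φ) :
    ∃ α : ℂ, φ = α • LinearMap.id :=
  ⟨_, linearMap_ext_of_f_comm ht (hφ _) (fun x => by simp)
    (isIntertwining_apply_weightVec_self ht hφ)⟩

theorem eq_zero_of_isIntertwining_of_ne (ht : (t : ℝ) ^ 2 ≠ 1) {c j : ℕ} (hcj : c ≠ j)
    {φ : Spin c →ₗ[ℂ] Spin j} (hφ : IsIntertwining (spinRep t c) (spinRep t j) φ) : φ = 0 := by
  refine linearMap_ext_of_f_comm ht (hφ _) (ψ := 0) (fun x => by simp) ?_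
  by_contra hne
  have hc := apply_mem_weightSpace_of_isIntertwining hφ (weightVec_self_mem_weightSpace c)
  have hj : φ (weightVec c c) ∈ weightSpace (spinRep t j) j := by
    rw [isIntertwining_apply_weightVec_self ht hφ]
    exact Submodule.smul_mem _ _ (weightVec_self_mem_weightSpace j)
  exact hcj (by exact_mod_cast weight_unique ht hne hc hj)

theorem apply_eq_smul_or_zero_of_isIntertwining_piRep (ht : (t : ℝ) ^ 2 ≠ 1) {S : Finset ℕ} {j : ℕ}
    {φ : ((c : S) → Spin c) →ₗ[ℂ] Spin j}
    (hφ : IsIntertwining (piRep fun c : S => spinRep t c) (spinRep t j) φ) :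
    ∃ α : ℂ, ∀ x, φ x = α • if h : j ∈ S then x ⟨j, h⟩ else 0 := by
  have apply_eq_sum (x : (c : S) → Spin c) : φ x = ∑ c : S, φ (Pi.single c (x c)) := by
    rw [← map_sum, Finset.univ_sum_single]
  have hsingle (c : S) := hφ.comp (isIntertwining_single (fun c : S => spinRep t c) c)
  have apply_single_of_ne {c : S} (hc : (c : ℕ) ≠ j) (y : Spin c) : φ (Pi.single c y) = 0 :=
    LinearMap.congr_fun (eq_zero_of_isIntertwining_of_ne ht hc (hsingle c)) y
  by_cases hj : j ∈ S
  · obtain ⟨α, hα⟩ := exists_eq_smul_id_of_isIntertwining ht (hsingle ⟨j, hj⟩)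
    refine ⟨α, fun x => ?_⟩
    rw [apply_eq_sum, Fintype.sum_eq_single ⟨j, hj⟩ fun c hc =>
      apply_single_of_ne (fun h => hc (Subtype.ext h)) (x c), dif_pos hj]
    exact LinearMap.congr_fun hα (x ⟨j, hj⟩)
  · refine ⟨0, fun x => ?_⟩
    rw [apply_eq_sum, zero_smul]
    exact Finset.sum_eq_zero fun c _ => apply_single_of_ne (fun h => hj (h ▸ c.2)) (x c)

end Schur

/-! ### Highest weight vectors -/

section HighestWeight

variable {N : Type*} [AddCommGroup N] [Module ℂ N]

theorem linearIndependent_of_mem_weightSpace (ht : (t : ℝ) ^ 2 ≠ 1)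
    {σ : Usu2 t →ₐ[ℂ] Module.End ℂ N} {ι : Type*} {r : ι → ℤ} (hr : Function.Injective r)
    {v : ι → N} (hv : ∀ i, v i ∈ weightSpace σ (r i)) (hv0 : ∀ i, v i ≠ 0) :
    LinearIndependent ℂ v :=
  Module.End.eigenvectors_linearIndependent' (σ (k t)) _ ((ofReal_zpow_injective ht).comp hr) v
    fun i => ⟨hv i, hv0 i⟩

/-- A nonzero vector of weight `m` killed by `e`. In a finite-dimensional representation it
generates a copy of `V^{m/2}`. -/
structure IsHighestWeightVector (σ : Usu2 t →ₐ[ℂ] Module.End ℂ N) (m : ℤ) (v : N) : Prop where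
  ne_zero : v ≠ 0
  mem_weightSpace : v ∈ weightSpace σ m
  e_apply : σ (e t) v = 0

/-- The normalized vector `f ^ n v`: the image of `e^{c/2}_{c/2 - n}` under the homomorphism
`V^{c/2} → N` that sends the highest weight vector to `v`. -/
def lowered (σ : Usu2 t →ₐ[ℂ] Module.End ℂ N) (c : ℕ) (v : N) (n : ℕ) : N :=
  (∏ i ∈ Finset.range n, (ladder t c i : ℂ)⁻¹) • (σ (f t) ^ n) v

/-- The linear map `V^{c/2} → N` with `e^{c/2}_{c/2 - n} ↦ lowered σ c v n`. -/
def highestWeightMap (σ : Usu2 t →ₐ[ℂ] Module.End ℂ N) (c : ℕ) (v : N) : Spin c →ₗ[ℂ] N :=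
  Fintype.linearCombination ℂ fun i : Fin (c + 1) => lowered σ c v (c - i)

variable {σ : Usu2 t →ₐ[ℂ] Module.End ℂ N} {v : N} {m : ℤ} {c : ℕ}

@[simp] theorem lowered_zero : lowered σ c v 0 = v := by simp [lowered]

theorem highestWeightMap_weightVec {i n : ℕ} (h : i + n = c) :
    highestWeightMap σ c v (weightVec c i) = lowered σ c v n := by
  rw [weightVec_of_le (by omega), highestWeightMap, Fintype.linearCombination_apply_single,
    one_smul, show c - i = n by omega]

theorem highestWeightMap_weightVec_self : highestWeightMap σ c v (weightVec c c) = v := by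
  rw [highestWeightMap_weightVec (add_zero c), lowered_zero]

theorem f_pow_apply_mem_weightSpace (hv : v ∈ weightSpace σ m) (n : ℕ) :
    (σ (f t) ^ n) v ∈ weightSpace σ (m - 2 * n) := by
  induction n with
  | zero => simpa using hv
  | succ n ih =>
    rw [pow_succ', Module.End.mul_apply, Nat.cast_succ, mul_add_one, ← sub_sub]
    exact f_apply_mem_weightSpace ih

theorem exists_f_pow_apply_eq_zero [FiniteDimensional ℂ N] (ht : (t : ℝ) ^ 2 ≠ 1)
    (hv : v ∈ weightSpace σ m) : ∃ n : ℕ, (σ (f t) ^ n) v = 0 := by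
  by_contra! hne
  have weight_injective : Function.Injective fun n : ℕ => m - 2 * n := fun i j h => by
    simpa using h
  have := linearIndependent_of_mem_weightSpace ht weight_injective
    (f_pow_apply_mem_weightSpace hv) hne
  exact Module.Finite.not_linearIndependent_of_infinite _ this

namespace IsHighestWeightVector

theorem e_f_pow_succ_apply (hv : IsHighestWeightVector σ m v) (n : ℕ) :
    σ (e t) ((σ (f t) ^ (n + 1)) v) =
      ((qInt t (m - n) * qInt t (n + 1) : ℝ) : ℂ) • (σ (f t) ^ n) v := by
  have commutator := e_f_apply_sub_f_e_apply (f_pow_apply_mem_weightSpace hv.mem_weightSpace n)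
  rw [pow_succ', Module.End.mul_apply, eq_add_of_sub_eq commutator,
    show m - 2 * n = m - n - n by ring, ← qInt_mul_sub_qInt_mul (m - n) n]
  cases n with
  | zero => simp [hv.e_apply]
  | succ n =>
    rw [hv.e_f_pow_succ_apply n, map_smul, ← Module.End.mul_apply, ← pow_succ', ← add_smul]
    push_cast
    ring_nf

theorem f_pow_succ_apply_eq_zero [FiniteDimensional ℂ N] (ht : (t : ℝ) ^ 2 ≠ 1)
    (hv : IsHighestWeightVector σ c v) : (σ (f t) ^ (c + 1)) v = 0 := by
  classical
  have hex := exists_f_pow_apply_eq_zero ht hv.mem_weightSpace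
  obtain ⟨n, hn⟩ : ∃ n, Nat.find hex = n + 1 :=
    Nat.exists_eq_succ_of_ne_zero fun h => hv.ne_zero (by simpa [h] using Nat.find_spec hex)
  have hfn : (σ (f t) ^ (n + 1)) v = 0 := hn ▸ Nat.find_spec hex
  have he := hv.e_f_pow_succ_apply n
  rw [hfn, map_zero, eq_comm, smul_eq_zero_iff_left (Nat.find_min hex (by omega)),
    Complex.ofReal_eq_zero, mul_eq_zero_iff_right (qInt_ne_zero ht (by omega))] at he
  have hcn : c = n := by
    by_contra hne
    exact qInt_ne_zero ht (by omega) he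
  rwa [hcn]

theorem lowered_mem_weightSpace (hv : IsHighestWeightVector σ c v) (n : ℕ) :
    lowered σ c v n ∈ weightSpace σ (c - 2 * n) :=
  Submodule.smul_mem _ _ (f_pow_apply_mem_weightSpace hv.mem_weightSpace n)

theorem e_lowered_succ (ht : (t : ℝ) ^ 2 ≠ 1) (hv : IsHighestWeightVector σ c v) {n : ℕ}
    (hn : n < c) : σ (e t) (lowered σ c v (n + 1)) = (ladder t c n : ℂ) • lowered σ c v n := by
  have hl : (ladder t c n : ℂ) ≠ 0 := Complex.ofReal_ne_zero.2 (ladder_ne_zero ht hn)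
  rw [lowered, map_smul, hv.e_f_pow_succ_apply, ← ladder_mul_self hn.le, lowered, smul_smul,
    smul_smul, Finset.prod_range_succ]
  congr 1
  push_cast
  field_simp

end IsHighestWeightVector

theorem f_lowered (ht : (t : ℝ) ^ 2 ≠ 1) {n : ℕ} (hn : n < c) :
    σ (f t) (lowered σ c v n) = (ladder t c n : ℂ) • lowered σ c v (n + 1) := by
  have hl : (ladder t c n : ℂ) ≠ 0 := Complex.ofReal_ne_zero.2 (ladder_ne_zero ht hn)
  rw [lowered, lowered, map_smul, pow_succ', Module.End.mul_apply, smul_smul,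
    Finset.prod_range_succ, mul_left_comm, mul_inv_cancel₀ hl, mul_one]

theorem isIntertwining_highestWeightMap [FiniteDimensional ℂ N] (ht : (t : ℝ) ^ 2 ≠ 1)
    (hv : IsHighestWeightVector σ c v) :
    IsIntertwining (spinRep t c) σ (highestWeightMap σ c v) := by
  refine isIntertwining_of_weightVec (fun i hi => ?_) (fun i hi => ?_) (fun i hi => ?_) <;>
    obtain ⟨n, hin⟩ := Nat.exists_eq_add_of_le hi
  · rw [spinRep_e_weightVec, map_smul, highestWeightMap_weightVec hin.symm]
    cases n with
    | zero => simp [hin, hv.e_apply]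
    | succ n =>
      rw [highestWeightMap_weightVec (n := n) (by omega), hv.e_lowered_succ ht (by omega),
        ladder_comm (j := n) (by omega)]
  · rw [highestWeightMap_weightVec hin.symm]
    cases i with
    | zero =>
      obtain rfl : c = n := by omega
      rw [spinRep_f_weightVec_zero, map_zero, lowered, map_smul, ← Module.End.mul_apply,
        ← pow_succ', hv.f_pow_succ_apply_eq_zero ht, smul_zero]
    | succ i =>
      rw [spinRep_f_weightVec_succ, map_smul, highestWeightMap_weightVec (n := n + 1) (by omega),
        f_lowered ht (by omega), ladder_comm (j := n) (by omega)]
  · rw [highestWeightMap_weightVec hin.symm, show 2 * (i : ℤ) - c = c - 2 * n by omega]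
    exact hv.lowered_mem_weightSpace n

theorem piRep_e_pow_eq_zero (S : Finset ℕ) :
    piRep (fun c : S => spinRep t c) (e t) ^ (S.sup id + 1) = 0 := by
  refine LinearMap.ext fun x => funext fun c => ?_
  have c_lt : (c : ℕ) < S.sup id + 1 := Nat.lt_succ_of_le (S.le_sup (f := id) c.2)
  rw [← map_pow, piRep_apply, map_pow, spinRep_e_pow_eq_zero c_lt]
  rfl

theorem lsum_highestWeightMap_injective [FiniteDimensional ℂ N] (ht : (t : ℝ) ^ 2 ≠ 1)
    {S : Finset ℕ} {v : S → N} (hv : ∀ c : S, IsHighestWeightVector σ (c : ℕ) (v c)) :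
    Function.Injective
      (LinearMap.lsum ℂ (fun c : S => Spin c) ℂ fun c => highestWeightMap σ c (v c)) := by
  have hφ := isIntertwining_lsum (fun c : S => spinRep t c)
    fun c => isIntertwining_highestWeightMap ht (hv c)
  refine injective_of_comp_eq_of_ker (hφ (e t))
    (fun x => ⟨_, LinearMap.congr_fun (piRep_e_pow_eq_zero S) x⟩) fun x hx hφx => ?_
  have x_eq (c : S) : x c = x c (Fin.last c) • weightVec c c :=
    eq_smul_weightVec_of_e_apply_eq_zero ht (congrFun hx c)
  have v_indep : LinearIndependent ℂ v := linearIndependent_of_mem_weightSpace ht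
    (Nat.cast_injective.comp Subtype.val_injective) (fun c => (hv c).mem_weightSpace)
    fun c => (hv c).ne_zero
  have sum_eq_zero : ∑ c : S, x c (Fin.last c) • v c = 0 := by
    rw [← hφx, LinearMap.lsum_apply, LinearMap.sum_apply]
    refine Finset.sum_congr rfl fun c _ => ?_
    conv_rhs => rw [LinearMap.comp_apply, LinearMap.proj_apply, x_eq c, map_smul,
      highestWeightMap_weightVec_self]
  funext c
  rw [x_eq c, Fintype.linearIndependent_iff.1 v_indep _ sum_eq_zero c, zero_smul, Pi.zero_apply]

end HighestWeight


/-! ### The Clebsch–Gordan decomposition -/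

section AntidiagonalVec

variable {M N : Type*} [AddCommGroup M] [Module ℂ M] [AddCommGroup N] [Module ℂ N]
  {σ : Usu2 t →ₐ[ℂ] Module.End ℂ M} {τ : Usu2 t →ₐ[ℂ] Module.End ℂ N} {x : M} {y : N}

/-- The vector `∑_{p + q = s} z^p e^p x ⊗ e^q y`. When `x` and `y` are weight vectors, it has some
weight `m`, and `z` is chosen as `-t^{-(m + 2)}` to make the sum for `e` applied to it telescope. -/
def antidiagonalVec (σ : Usu2 t →ₐ[ℂ] Module.End ℂ M) (τ : Usu2 t →ₐ[ℂ] Module.End ℂ N)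
    (z : ℂ) (x : M) (y : N) (s : ℕ) : M ⊗[ℂ] N :=
  ∑ p ∈ antidiagonal s, z ^ p.1 • ((σ (e t) ^ p.1) x ⊗ₜ (τ (e t) ^ p.2) y)

theorem e_pow_apply_mem_weightSpace {r : ℤ} (hx : x ∈ weightSpace σ r) (n : ℕ) :
    (σ (e t) ^ n) x ∈ weightSpace σ (r + 2 * n) := by
  induction n with
  | zero => simpa using hx
  | succ n ih =>
    rw [pow_succ', Module.End.mul_apply, Nat.cast_succ, mul_add_one, ← add_assoc]
    exact e_apply_mem_weightSpace ih

theorem antidiagonalVec_mem_weightSpace {r r' m : ℤ} (hx : x ∈ weightSpace σ r)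
    (hy : y ∈ weightSpace τ r') {s : ℕ} (hm : m = r + r' + 2 * s) (z : ℂ) :
    antidiagonalVec σ τ z x y s ∈ weightSpace (tensorRep σ τ) m := by
  refine Submodule.sum_mem _ fun p hp => Submodule.smul_mem _ _ ?_
  have hps : p.1 + p.2 = s := mem_antidiagonal.1 hp
  have hm' : m = (r + 2 * p.1) + (r' + 2 * p.2) := by omega
  exact hm' ▸ tmul_mem_weightSpace (e_pow_apply_mem_weightSpace hx p.1)
    (e_pow_apply_mem_weightSpace hy p.2)

theorem e_antidiagonalVec {r r' m : ℤ} (hx : x ∈ weightSpace σ r) (hy : y ∈ weightSpace τ r')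
    {s : ℕ} (hm : m = r + r' + 2 * s) (hxs : (σ (e t) ^ (s + 1)) x = 0)
    (hys : (τ (e t) ^ (s + 1)) y = 0) :
    tensorRep σ τ (e t) (antidiagonalVec σ τ (-((t : ℝ) : ℂ) ^ (-(m + 2))) x y s) = 0 := by
  set z : ℂ := -((t : ℝ) : ℂ) ^ (-(m + 2)) with hz
  let u (p q : ℕ) : M ⊗[ℂ] N :=
    (z ^ p * ((t : ℝ) : ℂ) ^ (r + 2 * p)) • ((σ (e t) ^ p) x ⊗ₜ (τ (e t) ^ q) y)
  have e_term (p : ℕ × ℕ) (hp : p ∈ antidiagonal s) :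
      tensorRep σ τ (e t) (z ^ p.1 • ((σ (e t) ^ p.1) x ⊗ₜ (τ (e t) ^ p.2) y)) =
        u p.1 (p.2 + 1) - u (p.1 + 1) p.2 := by
    have scalar_eq : z ^ (p.1 + 1) * ((t : ℝ) : ℂ) ^ (r + 2 * ((p.1 + 1 : ℕ) : ℤ)) =
        -(z ^ p.1 * ((t : ℝ) : ℂ) ^ (-(r' + 2 * p.2))) := by
      have hps : p.1 + p.2 = s := mem_antidiagonal.1 hp
      rw [pow_succ, mul_assoc, hz, neg_mul, ← zpow_add₀ (ne0 t), mul_neg,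
        show -(m + 2) + (r + 2 * ((p.1 + 1 : ℕ) : ℤ)) = -(r' + 2 * p.2) by omega]
    rw [map_smul, tensorRep_e_tmul_of_mem_weightSpace (e_pow_apply_mem_weightSpace hx p.1)
      (e_pow_apply_mem_weightSpace hy p.2)]
    simp only [u, scalar_eq, pow_succ' (σ (e t)), pow_succ' (τ (e t)), Module.End.mul_apply,
      smul_add, smul_smul, neg_smul, sub_neg_eq_add, add_comm]
  have sum_u_succ_right := Finset.Nat.sum_antidiagonal_succ' (n := s) (f := fun p => u p.1 p.2)
  have sum_u_succ_left := Finset.Nat.sum_antidiagonal_succ (n := s) (f := fun p => u p.1 p.2)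
  have u_right : u (s + 1) 0 = 0 := by simp [u, hxs]
  have u_left : u 0 (s + 1) = 0 := by simp [u, hys]
  simp only [u_right, u_left, zero_add] at sum_u_succ_left sum_u_succ_right
  rw [antidiagonalVec, map_sum, Finset.sum_congr rfl e_term, Finset.sum_sub_distrib,
    ← sum_u_succ_left, ← sum_u_succ_right, sub_self]

end AntidiagonalVec

theorem e_pow_weightVec_zero (a n : ℕ) : (spinRep t a (e t) ^ n) (weightVec a 0) =
    (∏ i ∈ Finset.range n, (ladder t a i : ℂ)) • weightVec a n := by
  induction n with
  | zero => simp
  | succ n ih =>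
    rw [pow_succ', Module.End.mul_apply, ih, map_smul, spinRep_e_weightVec, smul_smul,
      Finset.prod_range_succ]

theorem e_pow_weightVec_zero_apply_ne_zero (ht : (t : ℝ) ^ 2 ≠ 1) {a n : ℕ} (h : n ≤ a) :
    (spinRep t a (e t) ^ n) (weightVec a 0) ⟨n, Nat.lt_succ_of_le h⟩ ≠ 0 := by
  rw [e_pow_weightVec_zero, Pi.smul_apply, weightVec, if_pos rfl, smul_eq_mul, mul_one,
    Finset.prod_ne_zero_iff]
  exact fun i hi => Complex.ofReal_ne_zero.2
    (ladder_ne_zero ht ((Finset.mem_range.1 hi).trans_le h))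

theorem antidiagonalVec_weightVec_ne_zero (ht : (t : ℝ) ^ 2 ≠ 1) {a b p q : ℕ} (hp : p ≤ a)
    (hq : q ≤ b) {z : ℂ} (hz : z ≠ 0) :
    antidiagonalVec (spinRep t a) (spinRep t b) z (weightVec a 0) (weightVec b 0) (p + q) ≠ 0 := by
  let coord : Spin a ⊗[ℂ] Spin b →ₗ[ℂ] ℂ := LinearMap.mul' ℂ ℂ ∘ₗ TensorProduct.map
    (LinearMap.proj ⟨p, Nat.lt_succ_of_le hp⟩) (LinearMap.proj ⟨q, Nat.lt_succ_of_le hq⟩)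
  refine ne_of_apply_ne coord ?_
  rw [map_zero, antidiagonalVec, map_sum, Finset.sum_eq_single_of_mem (p, q) (by simp)]
  · simp only [map_smul, smul_eq_mul]
    exact mul_ne_zero (pow_ne_zero p hz) (mul_ne_zero (e_pow_weightVec_zero_apply_ne_zero ht hp)
      (e_pow_weightVec_zero_apply_ne_zero ht hq))
  · rintro ⟨p', q'⟩ hmem hne
    have p_ne : p ≠ p' := by
      rintro rfl
      exact hne (Prod.ext rfl (Nat.add_left_cancel (mem_antidiagonal.1 hmem)))
    simp [coord, e_pow_weightVec_zero, weightVec, p_ne]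

/-- The highest weight vector of weight `c` in `V^{a/2} ⊗ V^{b/2}`, built up from the lowest weight
vectors. -/
def cgVec (t : ℝˣ) (a b c : ℕ) : Spin a ⊗[ℂ] Spin b :=
  antidiagonalVec (spinRep t a) (spinRep t b) (-((t : ℝ) : ℂ) ^ (-((c : ℤ) + 2)))
    (weightVec a 0) (weightVec b 0) ((a + b + c) / 2)

theorem mem_cgSpins {a b c : ℕ} :
    c ∈ cgSpins a b ↔ ∃ i, i ≤ min a b ∧ c + 2 * i = a + b := by
  simp only [cgSpins, Finset.mem_filter, Finset.mem_Icc, Nat.even_iff]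
  constructor
  · rintro ⟨⟨h₁, h₂⟩, h₃⟩
    exact ⟨(a + b - c) / 2, by omega, by omega⟩
  · rintro ⟨i, hi, h⟩
    omega

theorem isHighestWeightVector_cgVec (ht : (t : ℝ) ^ 2 ≠ 1) {a b c : ℕ} (hc : c ∈ cgSpins a b) :
    IsHighestWeightVector (tensorRep (spinRep t a) (spinRep t b)) c (cgVec t a b c) := by
  obtain ⟨i, hi, h⟩ := mem_cgSpins.1 hc
  have hs : (a + b + c) / 2 = (a - i) + b := by omega
  have hm : (c : ℤ) = (2 * (0 : ℕ) - a) + (2 * (0 : ℕ) - b) + 2 * (((a - i) + b : ℕ) : ℤ) := by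
    omega
  rw [cgVec, hs]
  exact {
    ne_zero := antidiagonalVec_weightVec_ne_zero ht (Nat.sub_le a i) le_rfl
      (neg_ne_zero.2 (zpow_ne_zero _ (ne0 t)))
    mem_weightSpace := antidiagonalVec_mem_weightSpace (weightVec_mem_weightSpace a 0)
      (weightVec_mem_weightSpace b 0) hm _
    e_apply := e_antidiagonalVec (weightVec_mem_weightSpace a 0) (weightVec_mem_weightSpace b 0) hm
      (spinRep_e_pow_weightVec (by omega)) (spinRep_e_pow_weightVec (by omega)) }

theorem cgSpins_eq_image (a b : ℕ) :
    cgSpins a b = (Finset.range (min a b + 1)).image fun i => a + b - 2 * i := by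
  ext c
  simp only [mem_cgSpins, Finset.mem_image, Finset.mem_range, Nat.lt_succ_iff]
  exact exists_congr fun i => and_congr_right fun hi => by omega

theorem sum_cgSpins_add_one (a b : ℕ) : ∑ c ∈ cgSpins a b, (c + 1) = (a + 1) * (b + 1) := by
  have telescope {n : ℕ} (hn : n ≤ min a b + 1) :
      ∑ i ∈ Finset.range n, (a + b - 2 * i + 1) = n * (a + b + 2 - n) := by
    induction n with
    | zero => simp
    | succ n ih =>
      rw [Finset.sum_range_succ, ih (by omega)]
      zify [show 2 * n ≤ a + b by omega, show n ≤ a + b + 2 by omega,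
        show n + 1 ≤ a + b + 2 by omega]
      ring
  rw [cgSpins_eq_image, Finset.sum_image, telescope le_rfl]
  · obtain h | h := le_total a b
    · rw [min_eq_left h, show a + b + 2 - (a + 1) = b + 1 by omega]
    · rw [min_eq_right h, show a + b + 2 - (b + 1) = a + 1 by omega, mul_comm]
  · intro i hi i' hi' h
    simp only [Finset.coe_range, Set.mem_Iio] at hi hi' h
    omega

theorem finrank_pi_spin_cgSpins (a b : ℕ) : Module.finrank ℂ ((c : cgSpins a b) → Spin c) =
    Module.finrank ℂ (Spin a ⊗[ℂ] Spin b) := by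
  rw [Module.finrank_tensorProduct, Module.finrank_pi_fintype]
  simp only [Module.finrank_fin_fun]
  rw [Finset.sum_coe_sort (cgSpins a b) fun c => c + 1, sum_cgSpins_add_one]

/-- The isomorphism `⨁ V^{c/2} ≅ V^{a/2} ⊗ V^{b/2}` that takes the highest weight vector of
`V^{c/2}` to `cgVec t a b c`. -/
def cgEquiv (ht : (t : ℝ) ^ 2 ≠ 1) (a b : ℕ) :
    ((c : cgSpins a b) → Spin c) ≃ₗ[ℂ] Spin a ⊗[ℂ] Spin b :=
  LinearEquiv.ofInjectiveOfFinrankEq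
    (LinearMap.lsum ℂ (fun c : cgSpins a b => Spin c) ℂ fun c =>
      highestWeightMap (tensorRep (spinRep t a) (spinRep t b)) c (cgVec t a b c))
    (lsum_highestWeightMap_injective ht fun c => isHighestWeightVector_cgVec ht c.2)
    (finrank_pi_spin_cgSpins a b)

theorem cgEquiv_apply (ht : (t : ℝ) ^ 2 ≠ 1) {a b : ℕ} (x : (c : cgSpins a b) → Spin c) :
    cgEquiv ht a b x = ∑ c : cgSpins a b,
      highestWeightMap (tensorRep (spinRep t a) (spinRep t b)) c (cgVec t a b c) (x c) :=
  LinearMap.sum_apply ..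

theorem isIntertwining_cgEquiv (ht : (t : ℝ) ^ 2 ≠ 1) (a b : ℕ) :
    IsIntertwining (piRep fun c : cgSpins a b => spinRep t c)
      (tensorRep (spinRep t a) (spinRep t b)) (cgEquiv ht a b).toLinearMap :=
  isIntertwining_lsum _ fun c =>
    isIntertwining_highestWeightMap ht (isHighestWeightVector_cgVec ht c.2)

/-- The Clebsch–Gordan decomposition given by the highest weight vectors `cgVec t a b c`. -/
def cgDecomposition (ht : (t : ℝ) ^ 2 ≠ 1) (a b : ℕ) : CGDecomposition t a b where
  iso := (cgEquiv ht a b).symm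
  map_rep x w c := congrFun ((isIntertwining_cgEquiv ht a b).symm x w) c

/-! ### Reality of the coefficients -/

theorem star_spinRep_gen (a : ℕ) (g : Gen) (x : Spin a) :
    star (spinRep t a (gen t g) x) = spinRep t a (gen t g) (star x) := by
  have entry_real (i i' : Fin (a + 1)) :
      star (matRep t a (gen t g) i i') = matRep t a (gen t g) i i' := by
    cases g <;> simp [matRep, matE, matF, matK, matKinv, Matrix.diagonal_apply] <;>
      split_ifs <;> simp
  ext i
  simp [spinRep_apply, Matrix.mulVec, dotProduct, entry_real]

theorem star_tensorRep_f (a b : ℕ) (w : Spin a ⊗[ℂ] Spin b) :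
    star (tensorRep (spinRep t a) (spinRep t b) (f t) w) =
      tensorRep (spinRep t a) (spinRep t b) (f t) (star w) := by
  induction w with
  | zero => simp
  | add v w hv hw => simp only [map_add, star_add, hv, hw]
  | tmul v w =>
    simp only [tensorRep_apply_tmul, comul_eq_comulHom, comulHom_f, map_add, TensorProduct.map_tmul,
      star_add, TensorProduct.star_tmul, LinearMap.flip_apply, AlgHom.toLinearMap_apply,
      star_spinRep_gen]

theorem star_highestWeightMap {N : Type*} [AddCommGroup N] [Module ℂ N] [StarAddMonoid N]
    [StarModule ℂ N] {σ : Usu2 t →ₐ[ℂ] Module.End ℂ N}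
    (hf : ∀ x, star (σ (f t) x) = σ (f t) (star x)) (c : ℕ) (v : N) (x : Spin c) :
    star (highestWeightMap σ c v x) = highestWeightMap σ c (star v) (star x) := by
  simp [highestWeightMap, Fintype.linearCombination_apply, lowered, star_pow_apply hf]

theorem star_weightVec (a n : ℕ) : star (weightVec a n) = weightVec a n := by
  ext i
  simp [weightVec, apply_ite]

theorem star_cgVec (a b c : ℕ) : star (cgVec t a b c) = cgVec t a b c := by
  simp [cgVec, antidiagonalVec, TensorProduct.star_tmul, star_weightVec,
    star_pow_apply (star_spinRep_gen _ Gen.e)]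

theorem star_cgEquiv (ht : (t : ℝ) ^ 2 ≠ 1) {a b : ℕ} (x : (c : cgSpins a b) → Spin c) :
    star (cgEquiv ht a b x) = cgEquiv ht a b (star x) := by
  simp [cgEquiv_apply, star_highestWeightMap (star_tensorRep_f a b), star_cgVec]

theorem im_coeff_cgDecomposition (ht : (t : ℝ) ^ 2 ≠ 1) {a b : ℕ} (c : ℕ) (p : Fin (a + 1))
    (n : Fin (b + 1)) (m : Fin (c + 1)) : ((cgDecomposition ht a b).coeff c p n m).im = 0 := by
  have star_iso_symm (w : Spin a ⊗[ℂ] Spin b) :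
      star ((cgEquiv ht a b).symm w) = (cgEquiv ht a b).symm (star w) := by
    rw [LinearEquiv.eq_symm_apply, ← star_cgEquiv, LinearEquiv.apply_symm_apply]
  rw [CGDecomposition.coeff]
  split_ifs with h
  · rw [← Complex.conj_eq_iff_im, ← weightVec_val, ← weightVec_val]
    have := congrFun (congrFun (star_iso_symm (weightVec a p ⊗ₜ weightVec b n)) ⟨c, h⟩) m
    rwa [TensorProduct.star_tmul, star_weightVec, star_weightVec] at this
  · exact Complex.zero_im

/-! ### The Wigner–Eckart theorem -/

theorem CGDecomposition.isIntertwining_symm {a b : ℕ} (D : CGDecomposition t a b) :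
    IsIntertwining (piRep fun c : cgSpins a b => spinRep t c)
      (tensorRep (spinRep t a) (spinRep t b)) D.iso.symm.toLinearMap :=
  IsIntertwining.symm fun x w => funext (D.map_rep x w)

theorem exists_toMatrix'_eq_mul_coeff (ht : (t : ℝ) ^ 2 ≠ 1) {a b j : ℕ}
    (D : CGDecomposition t a b) {T : Spin a →ₗ[ℂ] (Spin b →ₗ[ℂ] Spin j)}
    (hT : IsTensorOperator (spinRep t a) (spinRep t b) (spinRep t j) T) :
    ∃ α : ℂ, ∀ p n m, LinearMap.toMatrix' (T (Pi.single p 1)) m n = α * D.coeff j p n m := by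
  obtain ⟨α, hα⟩ := apply_eq_smul_or_zero_of_isIntertwining_piRep ht
    (hT.isIntertwining_lift.comp D.isIntertwining_symm)
  refine ⟨α, fun p n m => ?_⟩
  have apply_single :=
    congrFun (hα (D.iso ((Pi.single p 1 : Spin a) ⊗ₜ (Pi.single n 1 : Spin b)))) m
  simp only [LinearMap.comp_apply, LinearEquiv.coe_coe, LinearEquiv.symm_apply_apply,
    TensorProduct.lift.tmul] at apply_single
  rw [LinearMap.toMatrix'_apply, apply_single, CGDecomposition.coeff]
  split_ifs <;> rfl

end Usu2

end

theorem theorem3 (t : ℝˣ) (ht : (t : ℝ) ^ 2 ≠ 1) (k l j : ℕ) :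
    (∃ D : Usu2.CGDecomposition t k l, ∀ (i : ℕ) (p : Fin (k + 1)) (n : Fin (l + 1))
      (m : Fin (i + 1)), (D.coeff i p n m).im = 0) ∧
    ∀ (D : Usu2.CGDecomposition t k l)
      (T : Usu2.Spin k →ₗ[ℂ] (Usu2.Spin l →ₗ[ℂ] Usu2.Spin j)),
      IsTensorOperator (Usu2.spinRep t k) (Usu2.spinRep t l) (Usu2.spinRep t j) T →
      ∃ α : ℂ,
        (∀ (p : Fin (k + 1)) (n : Fin (l + 1)) (m : Fin (j + 1)),
          LinearMap.toMatrix' (T (Pi.single p 1)) m n = α * D.coeff j p n m) ∧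
        ((∀ (p : Fin (k + 1)) (n : Fin (l + 1)) (m : Fin (j + 1)),
            (D.coeff j p n m).im = 0 ∧
              (LinearMap.toMatrix' (T (Pi.single p 1)) m n).im = 0) →
          α.im = 0) := by
  refine ⟨⟨Usu2.cgDecomposition ht k l, Usu2.im_coeff_cgDecomposition ht⟩, fun D T hT => ?_⟩
  obtain ⟨α, hα⟩ := Usu2.exists_toMatrix'_eq_mul_coeff ht D hT
  obtain ⟨β, hβ, hreal⟩ := exists_eq_mul_and_im_eq_zero
    (f := fun i : Fin (k + 1) × Fin (l + 1) × Fin (j + 1) =>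
      LinearMap.toMatrix' (T (Pi.single i.1 1)) i.2.2 i.2.1)
    (g := fun i => D.coeff j i.1 i.2.1 i.2.2) ⟨α, fun i => hα i.1 i.2.1 i.2.2⟩
  exact ⟨β, fun p n m => hβ (p, n, m), fun h => hreal fun i => h i.1 i.2.1 i.2.2⟩
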